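/- Let $\{S_n\}$ under $\mathbf P_z$ be simple random walk on $\mathbb Z^2$ started at $z$, and for $A\subseteq\mathbb Z^2$ put $\tau_A=\inf\{n\ge 1: S_n\in A\}$. For a finite nonempty $A\subset\mathbb Z^2$ and a directed nearest-neighbour edge $\vec e=\vec e(1)\to\vec e(2)$, the edge harmonic measure is $$\mathcal H^e_A(\vec e)=\lim_{\|z\|\to\infty}\mathbf P_z\big(\tau_A=\tau_{\vec e(2)}<\infty,\ S_{\tau_{\vec e(2)}-1}=\vec e(1)\big).$$ For $A\subseteq\mathbb Z^2$ let $\partial^eA$ be the set of directed nearest-neighbour edges $\vec e$ with $\vec e(1)\notin A$ and $\vec e(2)\in A$. Let $D_n=([-n,n]\cap\mathbb Z)\times\{0\}$. For positive integers $m\le N$, let $IA^{m,N}_k=(IV^{m,N}_k,IE^{m,N}_k)$, $k=0,1,2,\dots$, be the embedded (lazy, discrete-time) chain of the intermediate DLA process. It is the Markov chain on finite directed subgraphs of $\mathbb Z^2$ with $IA^{m,N}_0=(D_m,\emptyset)$ in which, given $IA^{m,N}_k=(V,E)$, for each $\vec e\in\partial^eV$ the next state is $(V\cup\{\vec e(1)\},E\cup\{\vec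 e\})$ with probability $\mathcal H^e_{V\cup D_N}(\vec e)$, and with the remaining probability the state does not change. Let $$F_m=[-m-\log m,\,m+\log m]\times[-\log m,\,\log m]\cap\mathbb Z^2,$$ and let $\vec F_m$ be the directed subgraph of $\mathbb Z^2$ whose vertex set is $F_m$ and whose edges are all directed nearest-neighbour edges with both endpoints in $F_m$. Then for every $C_1\in\mathbb R$ there is $M_0$ such that for every $\delta>0$ there is $N_0$ such that for all integers $N\ge N_0$ and all integers $m$ with $M_0\le m\le(1-\delta)N$, $$\mathbf P\big(IA^{m,N}_{2N}\subseteq\vec F_m\big)>1-\frac1{m^{C_1}}.$$ -/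

import Mathlib

open Filter MeasureTheory
open scoped ENNReal

namespace IntermediateDLA

/-- Vertices of the square lattice `ℤ²`. -/
abbrev Vertex : Type := ℤ × ℤ

/-- An ordered pair `(x, y)` of vertices, read as the directed edge `x → y`. -/
abbrev DirEdge : Type := Vertex × Vertex

/-- `x` and `y` are at Euclidean distance one. -/
def Adj (x y : Vertex) : Prop := (x.1 - y.1) ^ 2 + (x.2 - y.2) ^ 2 = 1

/-- The inner vertex boundary of `A`. -/
def innerBoundary (A : Set Vertex) : Set Vertex := {x | x ∈ A ∧ ∃ y, y ∉ A ∧ Adj x y}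

/-- The outer vertex boundary of `A`. -/
def outerBoundary (A : Set Vertex) : Set Vertex := {x | x ∉ A ∧ ∃ y, y ∈ A ∧ Adj x y}

/-- The edge boundary of `A`: lattice edges leading from the outer to the inner boundary. -/
def edgeBoundary (A : Set Vertex) : Set DirEdge :=
  {e | Adj e.1 e.2 ∧ e.1 ∈ outerBoundary A ∧ e.2 ∈ innerBoundary A}

/-! ### Simple random walk -/

/-- The four unit steps. -/
def unitSteps : Finset Vertex := {(1, 0), (-1, 0), (0, 1), (0, -1)}

theorem unitSteps_nonempty : unitSteps.Nonempty := ⟨(1, 0), by simp [unitSteps]⟩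

/-- The law of a single step: uniform on the four unit steps. -/
noncomputable def stepLaw : Measure Vertex :=
  (PMF.uniformOfFinset unitSteps unitSteps_nonempty).toMeasure

instance : IsProbabilityMeasure stepLaw := by unfold stepLaw; infer_instance

/-- The law of an i.i.d. sequence of steps. -/
noncomputable def stepsLaw : Measure (ℕ → Vertex) := Measure.infinitePi (fun _ => stepLaw)

instance : IsProbabilityMeasure stepsLaw := by unfold stepsLaw; infer_instance

/-- The trajectory of the walk started at `z` with increments `ξ`. -/
def walk (z : Vertex) (ξ : ℕ → Vertex) (n : ℕ) : Vertex := z + ∑ k ∈ Finset.range n, ξ k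

/-- The law of the simple random walk on `ℤ²` started at `z`. -/
noncomputable def walkLaw (z : Vertex) : Measure (ℕ → Vertex) := stepsLaw.map (walk z)

/-- `τ_A = n` for the trajectory `s`, where `τ_A = inf {k ≥ 1 : s k ∈ A}`. -/
def ReturnTimeEq (A : Set Vertex) (s : ℕ → Vertex) (n : ℕ) : Prop :=
  IsLeast {k : ℕ | 1 ≤ k ∧ s k ∈ A} n

/-- The event `{τ_A = τ_{e(2)}, S_{τ_{e(2)} - 1} = e(1)}` (the common time being finite). -/
def hitEvent (A : Set Vertex) (e : DirEdge) : Set (ℕ → Vertex) :=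
  {s | ∃ n, ReturnTimeEq A s n ∧ ReturnTimeEq {e.2} s n ∧ s (n - 1) = e.1}

/-- The edge harmonic measure `lim_{‖z‖ → ∞} P_z(τ_A = τ_{e(2)}, S_{τ_{e(2)} - 1} = e(1))`.
For finite `A` this limit exists, so it equals the lower limit written here; the lower limit
is used because it is a total function. `‖z‖ → ∞` is convergence along the complements of the
bounded sets. -/
noncomputable def edgeHarm (A : Set Vertex) (e : DirEdge) : ℝ≥0∞ :=
  liminf (fun z : Vertex => walkLaw z (hitEvent A e)) (Bornology.cobounded Vertex)

/-! ### Total mass of the edge harmonic measure is at most one -/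

theorem measurable_walk (z : Vertex) : Measurable (walk z) := by
  refine measurable_pi_lambda _ fun n => ?_
  unfold walk
  fun_prop

instance (z : Vertex) : IsProbabilityMeasure (walkLaw z) :=
  Measure.isProbabilityMeasure_map (measurable_walk z).aemeasurable

theorem measurableSet_hitEvent (A : Set Vertex) (e : DirEdge) :
    MeasurableSet (hitEvent A e) := by
  have hc : ∀ (k : ℕ) (B : Set Vertex), MeasurableSet {s : ℕ → Vertex | s k ∈ B} :=
    fun k B => measurable_pi_apply k (MeasurableSet.of_discrete (s := B))
  have hr : ∀ (B : Set Vertex) (n : ℕ),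
      MeasurableSet {s : ℕ → Vertex | ReturnTimeEq B s n} := by
    intro B n
    have h : {s : ℕ → Vertex | ReturnTimeEq B s n} =
        {s | 1 ≤ n ∧ s n ∈ B} ∩ ⋂ k : ℕ, {s | 1 ≤ k ∧ s k ∈ B → n ≤ k} := by
      ext s
      simp [ReturnTimeEq, IsLeast, lowerBounds]
    rw [h]
    have hk : ∀ k : ℕ, MeasurableSet {s : ℕ → Vertex | 1 ≤ k ∧ s k ∈ B} :=
      fun k => (MeasurableSet.const (1 ≤ k)).inter (hc k B)
    refine (hk n).inter (MeasurableSet.iInter fun k => ?_)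
    by_cases hnk : n ≤ k
    · simp [hnk]
    · simp only [hnk, imp_false]
      exact (hk k).compl
  have h : hitEvent A e = ⋃ n : ℕ, {s | ReturnTimeEq A s n} ∩
      ({s | ReturnTimeEq {e.2} s n} ∩ {s | s (n - 1) ∈ ({e.1} : Set Vertex)}) := by
    ext s
    simp [hitEvent]
  rw [h]
  exact MeasurableSet.iUnion fun n => (hr A n).inter ((hr {e.2} n).inter (hc (n - 1) {e.1}))

theorem hitEvent_disjoint (A : Set Vertex) {e f : DirEdge} (h : e ≠ f) :
    Disjoint (hitEvent A e) (hitEvent A f) := by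
  rw [Set.disjoint_left]
  rintro s ⟨n, hA, he, h1⟩ ⟨k, hA', hf, h2⟩
  obtain rfl : n = k := hA.unique hA'
  exact h (Prod.ext (h1.symm.trans h2) (he.1.2.symm.trans hf.1.2))

instance : (Bornology.cobounded Vertex).NeBot := by
  rw [Metric.cobounded_eq_cocompact, cocompact_eq_cofinite]
  infer_instance

theorem sum_edgeHarm_le_one (A : Set Vertex) (s : Finset DirEdge) :
    ∑ e ∈ s, edgeHarm A e ≤ 1 := by
  obtain ⟨U, hU⟩ := Ultrafilter.exists_le (Bornology.cobounded Vertex)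
  have hlim : ∀ e : DirEdge, ∃ L, Tendsto (fun z => walkLaw z (hitEvent A e)) U (nhds L) := by
    intro e
    obtain ⟨L, -, hL⟩ := isCompact_univ.ultrafilter_le_nhds
      (U.map fun z => walkLaw z (hitEvent A e)) (by simp)
    exact ⟨L, hL⟩
  choose L hL using hlim
  have h1 : ∀ e, edgeHarm A e ≤ L e := fun e => by
    rw [← (hL e).liminf_eq]
    exact liminf_le_liminf_of_le hU
  refine (Finset.sum_le_sum fun e _ => h1 e).trans ?_
  refine le_of_tendsto (tendsto_finsetSum s fun e _ => hL e) (Eventually.of_forall fun z => ?_)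
  rw [← measure_biUnion_finset (fun e _ f _ h => hitEvent_disjoint A h)
    fun e _ => measurableSet_hitEvent A e]
  exact prob_le_one

/-! ### The intermediate process -/

/-- The segment `D_n = ([-n, n] ∩ ℤ) × {0}`. -/
noncomputable def segment (n : ℕ) : Finset Vertex := Finset.Icc (-(n : ℤ)) n ×ˢ {0}

/-- A finite subgraph of the directed lattice, as its vertex set and its edge set. -/
abbrev State : Type := Finset Vertex × Finset DirEdge

/-- The subgraph obtained by adding the edge `e` and its starting point. -/
def State.addEdge (G : State) (e : DirEdge) : State := (insert e.1 G.1, insert e G.2)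

open scoped Classical in
/-- In the state `G`, the edge `e` is chosen with probability
`edgeHarm (V ∪ D_N) e` if it belongs to the edge boundary of the vertex set `V` of `G`, and
with probability zero otherwise. -/
noncomputable def edgeProb (N : ℕ) (G : State) (e : DirEdge) : ℝ≥0∞ :=
  if e ∈ edgeBoundary (G.1 : Set Vertex) then
    edgeHarm ((G.1 : Set Vertex) ∪ (segment N : Set Vertex)) e else 0

/-- The weights of the choice made in one step; `none` means that nothing is added. -/
noncomputable def choiceWeight (N : ℕ) (G : State) : Option DirEdge → ℝ≥0∞
  | some e => edgeProb N G e
  | none => 1 - ∑' e, edgeProb N G e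

theorem tsum_edgeProb_le_one (N : ℕ) (G : State) : ∑' e, edgeProb N G e ≤ 1 := by
  rw [ENNReal.tsum_eq_iSup_sum]
  refine iSup_le fun s => (Finset.sum_le_sum fun e _ => ?_).trans
    (sum_edgeHarm_le_one ((G.1 : Set Vertex) ∪ (segment N : Set Vertex)) s)
  unfold edgeProb
  split_ifs
  · exact le_rfl
  · exact zero_le

theorem tsum_choiceWeight (N : ℕ) (G : State) : ∑' o, choiceWeight N G o = 1 := by
  classical
  have h : ∑' o : Option DirEdge, (if o = none then 0 else choiceWeight N G o) =
      ∑' e, edgeProb N G e := by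
    rw [← (Option.some_injective DirEdge).tsum_eq]
    · exact tsum_congr fun e => by simp [choiceWeight]
    · rintro (_ | e) ho
      · simp at ho
      · exact ⟨e, rfl⟩
  rw [ENNReal.tsum_eq_add_tsum_ite none]
  refine Eq.trans ?_ (tsub_add_cancel_of_le (tsum_edgeProb_le_one N G))
  exact congrArg₂ (· + ·) rfl (by convert h)

/-- The random choice of the edge added in one step, if any. -/
noncomputable def choice (N : ℕ) (G : State) : PMF (Option DirEdge) :=
  ⟨choiceWeight N G, tsum_choiceWeight N G ▸ ENNReal.summable.hasSum⟩

/-- The one-step transition law: add the chosen edge, or stay put if none is chosen. -/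
noncomputable def transition (N : ℕ) (G : State) : PMF State :=
  (choice N G).map fun o => o.elim G G.addEdge

/-- The law of the embedded chain of the intermediate process after `k` steps, started from
the edgeless graph on `D_m`. -/
noncomputable def law (m N : ℕ) : ℕ → PMF State
  | 0 => PMF.pure (segment m, ∅)
  | k + 1 => (law m N k).bind (transition N)

/-- The box `F_m = [-m - log m, m + log m] × [-log m, log m] ∩ ℤ²`. -/
noncomputable def thinBox (m : ℕ) : Set Vertex :=
  {x | |(x.1 : ℝ)| ≤ m + Real.log m ∧ |(x.2 : ℝ)| ≤ Real.log m}

/-- `G` is contained in the subgraph of the directed lattice induced by the vertex set `A`: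
its vertices lie in `A` and its edges are lattice edges with both endpoints in `A`. -/
def State.Inside (G : State) (A : Set Vertex) : Prop :=
  (∀ x ∈ G.1, x ∈ A) ∧ ∀ e ∈ G.2, Adj e.1 e.2 ∧ e.1 ∈ A ∧ e.2 ∈ A

/-- The probability that the state after `k` steps is contained in the subgraph induced
by `A`. -/
noncomputable def probInside (m N k : ℕ) (A : Set Vertex) : ℝ :=
  ((law m N k).toOuterMeasure {G | G.Inside A}).toReal

end IntermediateDLA

/-!
The growth of the process is compared with a branching count whose rates are sublinear in the
length of a branch, so that the factorial coming from the time ordering of the additions wins.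

A vertex outside the box is joined to `D_m` by a chain of more than `log m` edges of the graph,
which were added one after the other, starting at `D_m`. The number of lattice paths of length `L`
starting in `D_m` is `(2m + 1) 4 ^ L`, the number of choices of `L` times out of `2N` is at most
`(2N) ^ L / L!`, and by `edgeHarm_le` the `i`-th edge of a path, which starts at height at most `i`,
is chosen at a given time with probability at most `C (η i + K) / N`. Here `η > 0` is as small as
desired, `K` depends on `η`, and `C` depends only on the relative distance of `m` from `N`. The
product of these factors is at most `(2m + 1) 2 ^ K' (C' η) ^ L` (`tsum_chainProb_le_pow`), and
`L > log m` makes this smaller than any given power of `m`.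

The bound on the edge harmonic measure needs no geometry of the cluster beyond `D_N ⊆ A`: a walk
that uses the edge `e` visits `x = e.1` before it hits `D = D_N`, which has probability
`G_D(z, x) / G_D(x, x)` for the walk started at `z`. Two facts are used.

* `G_D(x, x)` is at least the expected number of returns to the origin before time `h`, where `h`
  is the height of `x`; this is unbounded in `h` (`tendsto_returnSum`).
* Let `φ` be the probability to leave the vertical strip `|x.1| < R` before hitting `D`, and let
  `β` be its flux into `D`. If the probability to visit `x` before `D` is at least `w` outside the
  strip, then time reversal gives `w * G_D(x, x) * β ≤ φ(x)` (`mul_flux_reachProb_le`). On the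
  other hand `φ(x) ≤ 2 h β / k` at distance more than `2k` from the ends of `D`
  (`mul_stripProb_le`). For the latter, reflection shows that `φ` increases when `x` moves two steps
  away from the axis of symmetry. Summation by parts then shows that the sums of `φ` over
  horizontal segments are concave functions of the height; as they vanish at height zero, they grow
  at most linearly, and at height one they are controlled by `β`.
-/

namespace IntermediateDLA

/-! ### Averaging operator and Green potentials -/

/-- The transition operator of simple random walk: the mean of `f` over the four neighbours. -/
noncomputable def avg (f : Vertex → ℝ≥0∞) (x : Vertex) : ℝ≥0∞ := (∑ s ∈ unitSteps, f (x + s)) / 4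

theorem avg_apply (f : Vertex → ℝ≥0∞) (a b : ℤ) :
    avg f (a, b) = (f (a + 1, b) + f (a - 1, b) + f (a, b + 1) + f (a, b - 1)) / 4 := by
  simp [avg, unitSteps, sub_eq_add_neg, add_assoc]

theorem avg_mono {f g : Vertex → ℝ≥0∞} (h : f ≤ g) : avg f ≤ avg g := fun _ =>
  ENNReal.div_le_div_right (Finset.sum_le_sum fun _ _ => h _) _

theorem avg_add (f g : Vertex → ℝ≥0∞) : avg (f + g) = avg f + avg g := by
  funext x
  simp only [avg, Pi.add_apply, Finset.sum_add_distrib, ENNReal.add_div]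

theorem avg_const_mul (c : ℝ≥0∞) (f : Vertex → ℝ≥0∞) (x : Vertex) :
    avg (fun y => c * f y) x = c * avg f x := by
  simp only [avg, ← Finset.mul_sum, mul_div_assoc]

theorem card_unitSteps : unitSteps.card = 4 := by decide

theorem avg_one (x : Vertex) : avg 1 x = 1 := by
  simp [avg, card_unitSteps, ENNReal.div_self]

@[simp] theorem avg_zero : avg 0 = 0 := by
  funext x
  simp [avg]

theorem div_four_le_avg {s : Vertex} (hs : s ∈ unitSteps) (f : Vertex → ℝ≥0∞) (x : Vertex) :
    f (x + s) / 4 ≤ avg f x :=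
  ENNReal.div_le_div_right (Finset.single_le_sum (f := fun s => f (x + s)) (fun _ _ => zero_le) hs) _

theorem avg_iSup {f : ℕ → Vertex → ℝ≥0∞} (hf : Monotone f) (x : Vertex) :
    avg (fun y => ⨆ n, f n y) x = ⨆ n, avg (f n) x := by
  simp only [avg]
  rw [ENNReal.finsetSum_iSup_of_monotone (f := fun s n => f n (x + s)) fun s i j hij => hf hij _,
    ENNReal.iSup_div]

theorem neg_mem_unitSteps {s : Vertex} : -s ∈ unitSteps ↔ s ∈ unitSteps := by
  simp only [unitSteps, Finset.mem_insert, Finset.mem_singleton, Prod.ext_iff, Prod.fst_neg,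
    Prod.snd_neg]
  omega

/-- Summing over the steps `s` or over the steps `-s` is the same. -/
theorem sum_unitSteps_neg (f : Vertex → ℝ≥0∞) :
    ∑ s ∈ unitSteps, f (-s) = ∑ s ∈ unitSteps, f s := by
  refine Finset.sum_nbij' (fun s => -s) (fun s => -s) ?_ ?_ ?_ ?_ ?_ <;>
    simp +contextual [neg_mem_unitSteps]

/-- The transition operator is self-adjoint for the counting measure. -/
theorem tsum_mul_avg (f g : Vertex → ℝ≥0∞) :
    ∑' x, f x * avg g x = ∑' x, avg f x * g x := by
  have h : ∀ f g : Vertex → ℝ≥0∞, ∑' x, f x * avg g x =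
      (∑ s ∈ unitSteps, ∑' x, f x * g (x + s)) / 4 := by
    intro f g
    rw [← Summable.tsum_finsetSum fun _ _ => ENNReal.summable, ENNReal.div_eq_inv_mul,
      ← ENNReal.tsum_mul_left]
    refine tsum_congr fun x => ?_
    rw [avg, ← Finset.mul_sum, ENNReal.div_eq_inv_mul]
    ring
  rw [h]
  simp_rw [mul_comm (avg f _)]
  rw [h, ← sum_unitSteps_neg]
  congr 1
  refine Finset.sum_congr rfl fun s _ => ?_
  rw [← (Equiv.addRight s).tsum_eq]
  refine tsum_congr fun x => ?_
  simp [mul_comm]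

/-- `green D f n x` is the expectation of `∑ k < n, f (S k)`, restricted to the times `k` up to
which the walk started at `x` has avoided `D`. -/
noncomputable def green (D : Set Vertex) (f : Vertex → ℝ≥0∞) : ℕ → Vertex → ℝ≥0∞
  | 0 => 0
  | n + 1 => Dᶜ.indicator (f + avg (green D f n))

theorem green_mono (D : Set Vertex) (f : Vertex → ℝ≥0∞) : Monotone (green D f) := by
  refine monotone_nat_of_le_succ fun n => ?_
  induction n with
  | zero => exact fun _ => zero_le
  | succ n ih =>
    exact fun x => Set.indicator_le_indicator (add_le_add le_rfl (avg_mono ih x))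

theorem indicator_add_pi (s : Set Vertex) (f g : Vertex → ℝ≥0∞) :
    s.indicator (f + g) = s.indicator f + s.indicator g := Set.indicator_add' ..

theorem tsum_indicator_mul (s : Set Vertex) (f g : Vertex → ℝ≥0∞) :
    ∑' x, s.indicator f x * g x = ∑' x, f x * s.indicator g x := by
  classical
  refine tsum_congr fun x => ?_
  simp only [Set.indicator_apply]
  split_ifs <;> simp

/-- Decomposition of a Green potential at the last step instead of the first one. -/
theorem green_succ' (D : Set Vertex) (g : Vertex → ℝ≥0∞) (n : ℕ) :
    green D g (n + 1) = Dᶜ.indicator g + green D (avg (Dᶜ.indicator g)) n := by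
  induction n with
  | zero => simp [green]
  | succ n ih =>
    rw [green, ih, avg_add, indicator_add_pi, green, indicator_add_pi]

/-- Green potentials are self-adjoint for the counting measure. -/
theorem tsum_mul_green (D : Set Vertex) (f g : Vertex → ℝ≥0∞) (n : ℕ) :
    ∑' x, f x * green D g n x = ∑' x, green D f n x * g x := by
  induction n generalizing f g with
  | zero => simp [green]
  | succ n ih =>
    rw [green_succ', green, indicator_add_pi]
    simp only [Pi.add_apply, mul_add, add_mul]
    rw [ENNReal.tsum_add, ENNReal.tsum_add, tsum_indicator_mul, tsum_indicator_mul, ih,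
      ← tsum_mul_avg]

/-- The walk hits `D` at most once: the Green potential of the flux into `D` is at most one. -/
theorem green_flux_le (D : Set Vertex) (n : ℕ) :
    green D (avg (D.indicator 1)) n ≤ Dᶜ.indicator 1 := by
  induction n with
  | zero => exact fun _ => zero_le
  | succ n ih =>
    refine fun x => Set.indicator_le_indicator ?_
    refine (add_le_add le_rfl (avg_mono ih x)).trans ?_
    rw [← Pi.add_apply, ← avg_add, Set.indicator_self_add_compl, avg_one]
    rfl

open scoped Classical in
/-- `through D B f n x` is the part of `green D f n x` that comes from the times by which
the walk has visited `B`. -/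
noncomputable def through (D B : Set Vertex) (f : Vertex → ℝ≥0∞) : ℕ → Vertex → ℝ≥0∞
  | 0 => 0
  | n + 1 => fun x =>
    if x ∈ D then 0 else if x ∈ B then green D f (n + 1) x else avg (through D B f n) x

theorem through_mono (D B : Set Vertex) (f : Vertex → ℝ≥0∞) : Monotone (through D B f) := by
  refine monotone_nat_of_le_succ fun n => ?_
  induction n with
  | zero => exact fun _ => zero_le
  | succ n ih =>
    intro x
    simp only [through]
    split_ifs
    · exact le_rfl
    · exact green_mono D f (Nat.le_succ _) x
    · exact avg_mono ih x

theorem green_eq_add_through (D B : Set Vertex) (f : Vertex → ℝ≥0∞) (n : ℕ) :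
    green D f n = green (D ∪ B) f n + through D B f n := by
  induction n with
  | zero => simp [green, through]
  | succ n ih =>
    funext x
    by_cases hD : x ∈ D
    · simp [green, through, hD]
    by_cases hB : x ∈ B
    · simp [green, through, hB, hD]
    · simp only [green, through, hD, hB, Pi.add_apply, if_false]
      rw [Set.indicator_of_mem (by simpa using hD), Set.indicator_of_mem (by simp [hD, hB]), ih,
        avg_add]
      simp [add_assoc]

/-- Self-adjointness of `through`, obtained by subtracting the one of two Green potentials. -/
theorem tsum_mul_through (D B : Set Vertex) (f g : Vertex → ℝ≥0∞) (n : ℕ)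
    (h : ∑' x, f x * green D g n x ≠ ∞) :
    ∑' x, f x * through D B g n x = ∑' x, through D B f n x * g x := by
  have h1 := tsum_mul_green D f g n
  have h2 := tsum_mul_green (D ∪ B) f g n
  rw [green_eq_add_through D B g] at h h1
  rw [green_eq_add_through D B f] at h1
  simp only [Pi.add_apply, mul_add, add_mul, ENNReal.tsum_add, ← h2] at h h1
  exact (ENNReal.add_right_inj (ENNReal.add_ne_top.1 h).1).1 h1

/-! ### Probability of reaching a far set -/

open scoped Classical in
/-- The probability that the walk visits `B` by time `n` and before it visits `D`. -/
noncomputable def reach (D B : Set Vertex) : ℕ → Vertex → ℝ≥0∞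
  | 0 => B.indicator 1
  | n + 1 => fun x => if x ∈ B then 1 else if x ∈ D then 0 else avg (reach D B n) x

/-- The probability that the walk visits `B` before it visits `D`. -/
noncomputable def reachProb (D B : Set Vertex) (x : Vertex) : ℝ≥0∞ := ⨆ n, reach D B n x

theorem reach_mono (D B : Set Vertex) : Monotone (reach D B) := by
  refine monotone_nat_of_le_succ fun n => ?_
  induction n with
  | zero =>
    intro x
    by_cases h : x ∈ B <;> simp [reach, h]
  | succ n ih =>
    intro x
    simp only [reach]
    split_ifs
    · exact le_rfl
    · exact le_rfl
    · exact avg_mono ih x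

theorem reach_le_one (D B : Set Vertex) (n : ℕ) (x : Vertex) : reach D B n x ≤ 1 := by
  induction n generalizing x with
  | zero =>
    by_cases h : x ∈ B <;> simp [reach, h]
  | succ n ih =>
    simp only [reach]
    split_ifs
    · exact le_rfl
    · exact zero_le
    · exact (avg_mono (g := 1) (fun y => ih y) x).trans (avg_one x).le

theorem reachProb_le_one (D B : Set Vertex) (x : Vertex) : reachProb D B x ≤ 1 :=
  iSup_le fun n => reach_le_one D B n x

theorem reachProb_of_mem {D B : Set Vertex} {x : Vertex} (h : x ∈ B) : reachProb D B x = 1 :=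
  (reachProb_le_one D B x).antisymm (le_iSup_of_le 0 (by simp [reach, h]))

theorem reachProb_eq_zero {D B : Set Vertex} {x : Vertex} (h : x ∈ D) (hB : x ∉ B) :
    reachProb D B x = 0 := by
  refine le_antisymm (iSup_le fun n => ?_) zero_le
  cases n <;> simp [reach, h, hB]

theorem avg_reachProb_le {D B : Set Vertex} {x : Vertex} (h : x ∉ D) :
    avg (reachProb D B) x ≤ reachProb D B x := by
  have : avg (reachProb D B) x = ⨆ n, avg (reach D B n) x := avg_iSup (reach_mono D B) x
  rw [this]
  refine iSup_le fun n => le_iSup_of_le (n + 1) ?_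
  simp only [reach]
  split_ifs
  · exact (avg_mono (g := 1) (fun y => reach_le_one D B n y) x).trans (avg_one x).le
  · exact le_rfl

/-- If the Green potential of `f` is at least `c` on `B`, then its part coming from the times
after a visit to `B` is at least `c` times the probability of such a visit. -/
theorem mul_reachProb_le_iSup_through {D B : Set Vertex} (hDB : Disjoint D B)
    {f : Vertex → ℝ≥0∞} {c : ℝ≥0∞} (hc : ∀ z ∈ B, c ≤ ⨆ n, green D f n z) (x : Vertex) :
    c * reachProb D B x ≤ ⨆ n, through D B f n x := by
  have hB : ∀ z ∈ B, c ≤ ⨆ n, through D B f n z := by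
    intro z hz
    refine (hc z hz).trans (iSup_le fun n => le_iSup_of_le (n + 1) ?_)
    simp only [through, if_neg (Set.disjoint_right.1 hDB hz), if_pos hz]
    exact green_mono D f (Nat.le_succ n) z
  rw [reachProb, ENNReal.mul_iSup]
  refine iSup_le fun n => ?_
  induction n generalizing x with
  | zero =>
    by_cases h : x ∈ B
    · simpa [reach, h] using hB x h
    · simp [reach, h]
  | succ n ih =>
    simp only [reach]
    split_ifs with h h'
    · simpa using hB x h
    · simp
    · rw [← avg_const_mul]
      refine (avg_mono ih x).trans ?_
      rw [avg_iSup (through_mono D B f)]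
      refine iSup_le fun k => le_iSup_of_le (k + 1) ?_
      simp only [through, if_neg h', if_neg h, le_refl]

/-- The probability to hit `D` after a visit to `B` is at most the probability of reaching `B`
before `D`. -/
theorem through_flux_le (D B : Set Vertex) (n : ℕ) (x : Vertex) :
    through D B (avg (D.indicator 1)) n x ≤ reachProb D B x := by
  induction n generalizing x with
  | zero => exact zero_le
  | succ n ih =>
    simp only [through]
    split_ifs with h h'
    · exact zero_le
    · rw [reachProb_of_mem h']
      exact (green_flux_le D _ x).trans (Set.indicator_le_self' (fun _ _ => zero_le) x)
    · exact (avg_mono ih x).trans (avg_reachProb_le h)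

/-- The indicator function of a single vertex. -/
noncomputable def delta (x : Vertex) : Vertex → ℝ≥0∞ := Pi.single x 1

@[simp] theorem delta_self (x : Vertex) : delta x x = 1 := by simp [delta]

theorem delta_of_ne {x y : Vertex} (h : y ≠ x) : delta x y = 0 := by simp [delta, h]

theorem tsum_delta_mul (x : Vertex) (f : Vertex → ℝ≥0∞) :
    ∑' y, delta x y * f y = f x := by
  rw [tsum_eq_single x]
  · simp
  · intro y hy
    simp [delta_of_ne hy]

theorem tsum_avg_indicator_mul (D : Finset Vertex) (f : Vertex → ℝ≥0∞) :
    ∑' x, avg ((D : Set Vertex).indicator 1) x * f x = ∑ y ∈ D, avg f y := by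
  rw [← tsum_mul_avg]
  calc ∑' x, (D : Set Vertex).indicator 1 x * avg f x
      = ∑' x, (D : Set Vertex).indicator (avg f) x := by
        refine tsum_congr fun x => ?_
        by_cases h : x ∈ D <;> simp [h]
    _ = _ := by
        rw [← tsum_subtype, Finset.tsum_subtype']

/-- **Green's identity.** If the Green function `G_D(·, x)` is at least `c` on `B`, then `c`
times the flux of `reachProb D B` into `D` is at most the value of `reachProb D B` at `x`:
reversing time, both sides count the paths from `D` to `x` through `B`. -/
theorem mul_flux_reachProb_le (D : Finset Vertex) {B : Set Vertex}
    (hDB : Disjoint (D : Set Vertex) B) (x : Vertex) {c : ℝ≥0∞}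
    (hc : ∀ z ∈ B, c ≤ ⨆ n, green D (delta x) n z) :
    c * ∑ y ∈ D, avg (reachProb D B) y ≤ reachProb D B x := by
  calc c * ∑ y ∈ D, avg (reachProb D B) y
      = ∑ y ∈ D, avg (fun z => c * reachProb D B z) y := by
        simp only [avg_const_mul, Finset.mul_sum]
    _ ≤ ∑ y ∈ D, avg (fun z => ⨆ n, through D B (delta x) n z) y :=
        Finset.sum_le_sum fun y _ =>
          avg_mono (fun z => mul_reachProb_le_iSup_through hDB hc z) y
    _ = ⨆ n, ∑ y ∈ D, avg (through D B (delta x) n) y := by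
        simp only [avg_iSup (through_mono (D : Set Vertex) B _)]
        exact ENNReal.finsetSum_iSup_of_monotone fun y i j hij =>
          avg_mono (through_mono _ _ _ hij) y
    _ ≤ reachProb D B x := by
        refine iSup_le fun n => ?_
        have hfin : green (D : Set Vertex) (avg ((D : Set Vertex).indicator 1)) n x ≠ ∞ :=
          ne_top_of_le_ne_top ENNReal.one_ne_top ((green_flux_le _ n x).trans
            (Set.indicator_le_self' (fun _ _ => zero_le) x))
        rw [← tsum_avg_indicator_mul]
        simp_rw [mul_comm (avg _ _)]
        rw [← tsum_mul_through _ _ _ _ _ (by rwa [tsum_delta_mul]), tsum_delta_mul]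
        exact through_flux_le _ _ n x

/-! ### Reaching the outside of a vertical strip before a segment -/

/-- The outside of the vertical strip `(-R, R) × ℤ`. -/
def farSet (R : ℕ) : Set Vertex := {x | (R : ℤ) ≤ |x.1|}

@[simp] theorem mem_farSet {R : ℕ} {x : Vertex} : x ∈ farSet R ↔ (R : ℤ) ≤ |x.1| := Iff.rfl

theorem mem_segment {n : ℕ} {x : Vertex} : x ∈ segment n ↔ |x.1| ≤ n ∧ x.2 = 0 := by
  rw [segment, Finset.mem_product, Finset.mem_Icc, Finset.mem_singleton, abs_le]

theorem disjoint_segment_farSet {N R : ℕ} (h : N < R) :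
    Disjoint (segment N : Set Vertex) (farSet R) := by
  rw [Set.disjoint_left]
  intro x hx hx'
  have := (mem_segment.1 (Finset.mem_coe.1 hx)).1
  simp only [mem_farSet] at hx'
  omega

theorem reach_neg_fst (N R n : ℕ) (a b : ℤ) :
    reach (segment N) (farSet R) n (-a, b) = reach (segment N) (farSet R) n (a, b) := by
  induction n generalizing a b with
  | zero => classical simp [reach, Set.indicator_apply]
  | succ n ih =>
    simp only [reach, avg_apply, Finset.mem_coe, mem_segment, mem_farSet, abs_neg]
    rw [show -a + 1 = -(a - 1) by ring, show -a - 1 = -(a + 1) by ring, ih, ih, ih, ih,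
      add_comm (reach _ _ n (a - 1, b))]

theorem reach_neg_snd (N R n : ℕ) (a b : ℤ) :
    reach (segment N) (farSet R) n (a, -b) = reach (segment N) (farSet R) n (a, b) := by
  induction n generalizing a b with
  | zero => classical simp [reach, Set.indicator_apply]
  | succ n ih =>
    simp only [reach, avg_apply, Finset.mem_coe, mem_segment, mem_farSet, neg_eq_zero]
    rw [show -b + 1 = -(b - 1) by ring, show -b - 1 = -(b + 1) by ring, ih, ih, ih, ih,
      add_right_comm (_ + _) (reach _ _ n (a, b - 1))]

/-- Moving the starting point two steps away from the axis of symmetry helps the walk to leave the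
strip before it hits the segment. Steps of two are needed: two walks that are mirror images of
each other in a line meet only if the line contains lattice points. -/
theorem reach_le_add_two {N R : ℕ} (h : N < R) (n : ℕ) {a : ℤ} (ha : -1 ≤ a) (b : ℤ) :
    reach (segment N) (farSet R) n (a, b) ≤ reach (segment N) (farSet R) n (a + 2, b) := by
  obtain rfl | ha : a = -1 ∨ 0 ≤ a := by omega
  · exact (reach_neg_fst N R n 1 b).le
  induction n generalizing a b with
  | zero =>
    refine Set.indicator_apply_le' (fun hx => ?_) fun _ => zero_le
    rw [reach, Set.indicator_of_mem]
    · rfl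
    simp only [mem_farSet] at hx ⊢
    rw [abs_of_nonneg (by omega)] at hx ⊢
    omega
  | succ n ih =>
    by_cases h1 : (R : ℤ) ≤ |a + 2|
    · refine (reach_le_one _ _ _ _).trans (le_of_eq ?_)
      simp [reach, h1]
    by_cases h2 : |a| ≤ N ∧ b = 0
    · refine le_trans (le_of_eq ?_) zero_le
      have : ¬ (R : ℤ) ≤ |a| := by omega
      simp only [reach, mem_farSet, this, Finset.mem_coe, mem_segment, h2, and_self,
        if_true, if_false]
    have h3 : ¬ (R : ℤ) ≤ |a| := by
      rw [abs_of_nonneg (by omega)] at h1 ⊢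
      omega
    have h4 : ¬ (|a + 2| ≤ N ∧ b = 0) := by
      rw [abs_of_nonneg (by omega)] at h2 ⊢
      omega
    simp only [reach, mem_farSet, Finset.mem_coe, mem_segment, h1, h2, h3, h4,
      if_false, avg_apply]
    refine ENNReal.div_le_div_right (add_le_add (add_le_add (add_le_add ?_ ?_) ?_) ?_) _
    · have := ih (a := a + 1) (by omega) b (by omega)
      rwa [show a + 1 + 2 = a + 2 + 1 by ring] at this
    · obtain rfl | ha' : a = 0 ∨ 0 ≤ a - 1 := by omega
      · exact (reach_neg_fst N R n 1 b).le
      · have := ih (a := a - 1) (by omega) b ha'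
        rwa [show a - 1 + 2 = a + 2 - 1 by ring] at this
    · exact ih (by omega) _ ha
    · exact ih (by omega) _ ha

/-- The function `reachProb (segment N) (farSet R)`, as a real-valued function of two integers. -/
noncomputable def stripProb (N R : ℕ) (a b : ℤ) : ℝ :=
  (reachProb (segment N) (farSet R) (a, b)).toReal

theorem reachProb_ne_top (D B : Set Vertex) (x : Vertex) : reachProb D B x ≠ ∞ :=
  ne_top_of_le_ne_top ENNReal.one_ne_top (reachProb_le_one D B x)

theorem stripProb_nonneg (N R : ℕ) (a b : ℤ) : 0 ≤ stripProb N R a b := ENNReal.toReal_nonneg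

theorem stripProb_neg_fst (N R : ℕ) (a b : ℤ) : stripProb N R (-a) b = stripProb N R a b := by
  simp only [stripProb, reachProb, reach_neg_fst]

theorem stripProb_neg_snd (N R : ℕ) (a b : ℤ) : stripProb N R a (-b) = stripProb N R a b := by
  simp only [stripProb, reachProb, reach_neg_snd]

theorem stripProb_le_add_two {N R : ℕ} (h : N < R) {a : ℤ} (ha : -1 ≤ a) (b : ℤ) :
    stripProb N R a b ≤ stripProb N R (a + 2) b :=
  ENNReal.toReal_mono (reachProb_ne_top _ _ _) (iSup_mono fun n => reach_le_add_two h n ha b)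

theorem stripProb_zero {N R : ℕ} (h : N < R) {a : ℤ} (ha : |a| ≤ N) : stripProb N R a 0 = 0 := by
  rw [stripProb, reachProb_eq_zero, ENNReal.toReal_zero]
  · exact mem_segment.2 ⟨ha, rfl⟩
  · simp only [mem_farSet]
    omega

theorem toReal_avg {f : Vertex → ℝ≥0∞} (hf : ∀ x, f x ≠ ∞) (a b : ℤ) :
    (avg f (a, b)).toReal = ((f (a + 1, b)).toReal + (f (a - 1, b)).toReal +
      (f (a, b + 1)).toReal + (f (a, b - 1)).toReal) / 4 := by
  rw [avg_apply, ENNReal.toReal_div, ENNReal.toReal_add, ENNReal.toReal_add, ENNReal.toReal_add]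
  · rfl
  all_goals simp [hf]

theorem stripProb_superharmonic (N R : ℕ) (a : ℤ) {b : ℤ} (hb : b ≠ 0) :
    stripProb N R (a + 1) b + stripProb N R (a - 1) b + stripProb N R a (b + 1) +
      stripProb N R a (b - 1) ≤ 4 * stripProb N R a b := by
  have h : avg (reachProb (segment N) (farSet R)) (a, b) ≤
      reachProb (segment N) (farSet R) (a, b) :=
    avg_reachProb_le fun h => hb (mem_segment.1 (Finset.mem_coe.1 h)).2
  have := ENNReal.toReal_mono (reachProb_ne_top _ _ _) h
  rw [toReal_avg (reachProb_ne_top _ _), div_le_iff₀ (by norm_num)] at this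
  simp only [stripProb]
  linarith

/-- The sum of `stripProb N R · b` over the symmetric interval `[-r, r]`. -/
noncomputable def rowSum (N R r : ℕ) (b : ℤ) : ℝ :=
  stripProb N R 0 b + 2 * ∑ j ∈ Finset.range r, stripProb N R (j + 1) b

theorem rowSum_succ (N R r : ℕ) (b : ℤ) :
    rowSum N R (r + 1) b = rowSum N R r b + 2 * stripProb N R (r + 1) b := by
  rw [rowSum, rowSum, Finset.sum_range_succ]
  ring

theorem rowSum_zero {N R r : ℕ} (h : N < R) (hr : r ≤ N) : rowSum N R r 0 = 0 := by
  rw [rowSum, stripProb_zero h (by simp), Finset.sum_eq_zero, mul_zero, add_zero]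
  intro j hj
  rw [Finset.mem_range] at hj
  exact stripProb_zero h (by rw [abs_of_nonneg (by positivity)]; omega)

/-- Summation by parts over a row: only the flux through the two ends remains. -/
theorem rowSum_superharmonic (N R r : ℕ) {b : ℤ} (hb : b ≠ 0) :
    rowSum N R r (b + 1) + rowSum N R r (b - 1) +
      2 * (stripProb N R (r + 1) b - stripProb N R r b) ≤ 2 * rowSum N R r b := by
  induction r with
  | zero =>
    have h := stripProb_superharmonic N R 0 hb
    have h' := stripProb_neg_fst N R 1 b
    simp only [rowSum, Finset.range_zero, Finset.sum_empty, Nat.cast_zero, zero_add, zero_sub]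
      at h ⊢
    linarith
  | succ r ih =>
    have h := stripProb_superharmonic N R (r + 1) hb
    simp only [rowSum_succ, Nat.cast_add, Nat.cast_one, add_sub_cancel_right] at h ⊢
    linarith

/-- A concave sequence vanishing at zero grows at most linearly. -/
theorem le_mul_of_concave {u : ℕ → ℝ} (h0 : u 0 = 0)
    (hu : ∀ n, u (n + 2) + u n ≤ 2 * u (n + 1)) (n : ℕ) : u n ≤ n * u 1 := by
  have h : ∀ n, u (n + 1) - u n ≤ u 1 := by
    intro n
    induction n with
    | zero => simp [h0]
    | succ n ih => linarith [hu n]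
  induction n with
  | zero => simp [h0]
  | succ n ih =>
    push_cast
    linarith [h n]

/-- By monotonicity in steps of two, the values at a height `n` summed over the two rows
`[-r, r]` and `[-r - 1, r + 1]` are concave in `n`, hence at most `n` times those at height one. -/
theorem rowSum_add_rowSum_le {N R r : ℕ} (h : N < R) (hr : r + 1 ≤ N) (n : ℕ) :
    rowSum N R r n + rowSum N R (r + 1) n ≤ n * (rowSum N R r 1 + rowSum N R (r + 1) 1) := by
  refine le_mul_of_concave (u := fun n : ℕ => rowSum N R r n + rowSum N R (r + 1) n) ?_
    (fun n => ?_) n |>.trans_eq (by simp)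
  · simp [rowSum_zero h hr, rowSum_zero h (Nat.le_of_succ_le hr)]
  · have hb : ((n : ℤ) + 1) ≠ 0 := by omega
    have h1 := rowSum_superharmonic N R r hb
    have h2 := rowSum_superharmonic N R (r + 1) hb
    have h3 := stripProb_le_add_two h (a := r) (by omega) (n + 1)
    push_cast at h1 h2 ⊢
    rw [show (n : ℤ) + 1 + 1 = n + 2 by ring, add_sub_cancel_right] at h1 h2
    rw [show (r : ℤ) + 1 + 1 = r + 2 by ring] at h2
    linarith

theorem mul_stripProb_le_rowSum {N R : ℕ} (h : N < R) (a k : ℕ) (b : ℤ) :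
    2 * k * stripProb N R a b ≤ rowSum N R (a + 2 * k) b := by
  have hk : ∀ k : ℕ, stripProb N R a b ≤ stripProb N R (a + 2 * k) b := by
    intro k
    induction k with
    | zero => simp
    | succ k ih =>
      refine ih.trans ((stripProb_le_add_two h (by omega) b).trans_eq ?_)
      push_cast
      ring_nf
  induction k with
  | zero =>
    simp only [Nat.cast_zero, mul_zero, zero_mul, add_zero, rowSum]
    have := stripProb_nonneg N R
    exact add_nonneg (this _ _) (mul_nonneg zero_le_two (Finset.sum_nonneg fun _ _ => this _ _))
  | succ k ih =>
    rw [show a + 2 * (k + 1) = a + 2 * k + 1 + 1 by ring, rowSum_succ, rowSum_succ]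
    have h1 := hk (k + 1)
    have h2 := stripProb_nonneg N R (↑(a + 2 * k) + 1) b
    push_cast at h1 h2 ih ⊢
    rw [show (a : ℤ) + 2 * (k + 1) = a + 2 * k + 1 + 1 by ring] at h1
    linarith

theorem rowSum_mono (N R : ℕ) (b : ℤ) : Monotone fun r => rowSum N R r b :=
  monotone_nat_of_le_succ fun r => by
    have := stripProb_nonneg N R (r + 1) b
    simp only [rowSum_succ]
    linarith

theorem rowSum_eq_sum (N R r : ℕ) (b : ℤ) :
    rowSum N R r b = ∑ a ∈ Finset.Icc (-(r : ℤ)) r, stripProb N R a b := by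
  induction r with
  | zero => simp [rowSum]
  | succ r ih =>
    have : Finset.Icc (-((r + 1 : ℕ) : ℤ)) ((r + 1 : ℕ) : ℤ) =
        insert ((r : ℤ) + 1) (insert (-((r : ℤ) + 1)) (Finset.Icc (-(r : ℤ)) r)) := by
      ext x
      simp only [Finset.mem_Icc, Finset.mem_insert]
      omega
    rw [this, Finset.sum_insert, Finset.sum_insert, rowSum_succ, ih, stripProb_neg_fst]
    · ring
    · simp
    · simp only [Finset.mem_insert, Finset.mem_Icc]
      omega

/-- The flux into the segment, as a real number. -/
noncomputable def segmentFlux (N R : ℕ) : ℝ :=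
  (∑ y ∈ segment N, avg (reachProb (segment N) (farSet R)) y).toReal

theorem avg_reachProb_ne_top (D B : Set Vertex) (y : Vertex) : avg (reachProb D B) y ≠ ∞ :=
  ne_top_of_le_ne_top ENNReal.one_ne_top
    ((avg_mono (g := 1) (fun y => reachProb_le_one D B y) y).trans (avg_one y).le)

theorem segmentFlux_eq (N R : ℕ) : segmentFlux N R =
    ∑ a ∈ Finset.Icc (-(N : ℤ)) N, (stripProb N R (a + 1) 0 + stripProb N R (a - 1) 0 +
      stripProb N R a 1 + stripProb N R a (-1)) / 4 := by
  rw [segmentFlux, ENNReal.toReal_sum fun y _ => avg_reachProb_ne_top _ _ y]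
  nth_rewrite 1 [segment]
  rw [Finset.sum_product]
  simp only [Finset.sum_singleton]
  refine Finset.sum_congr rfl fun a _ => ?_
  rw [toReal_avg (reachProb_ne_top _ _)]
  simp [stripProb]

theorem rowSum_one_le (N R : ℕ) : rowSum N R N 1 ≤ 4 * segmentFlux N R := by
  rw [segmentFlux_eq, rowSum_eq_sum, Finset.mul_sum]
  refine Finset.sum_le_sum fun a _ => ?_
  have := stripProb_nonneg N R
  linarith [this (a + 1) 0, this (a - 1) 0, this a (-1)]

theorem stripProb_pos {N R : ℕ} (j : ℕ) (hj : j + N < R) : 0 < stripProb N R (R - j) 0 := by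
  have : 0 < reachProb (segment N) (farSet R) ((R : ℤ) - j, 0) := by
    induction j with
    | zero => simp [reachProb_of_mem]
    | succ j ih =>
      refine lt_of_lt_of_le ?_ (avg_reachProb_le fun h => ?_)
      · refine lt_of_lt_of_le ?_ (div_four_le_avg (s := (1, 0)) (by simp [unitSteps]) _ _)
        refine ENNReal.div_pos ?_ (by simp)
        have := ih (by omega)
        rw [Prod.mk_add_mk, add_zero, show (R : ℤ) - (j + 1 : ℕ) + 1 = R - j by push_cast; ring]
        exact this.ne'
      · have := (mem_segment.1 (Finset.mem_coe.1 h)).1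
        have h2 := le_abs_self ((R : ℤ) - (j + 1 : ℕ))
        simp only at this
        omega
  exact ENNReal.toReal_pos this.ne' (reachProb_ne_top _ _ _)

theorem segmentFlux_pos {N R : ℕ} (h : N < R) : 0 < segmentFlux N R := by
  rw [segmentFlux_eq]
  have hn := stripProb_nonneg N R
  have hp := stripProb_pos (N := N) (R := R) (R - N - 1) (by omega)
  refine Finset.sum_pos' (fun a _ => ?_) ⟨N, by simp, ?_⟩
  · linarith [hn (a + 1) 0, hn (a - 1) 0, hn a 1, hn a (-1)]
  · rw [show (R : ℤ) - (R - N - 1 : ℕ) = N + 1 by omega] at hp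
    linarith [hn ((N : ℤ) - 1) 0, hn N 1, hn N (-1)]

/-- At height `h` above a point at distance more than `2k` from the ends of the segment, the
probability to leave the strip is at most `2h / k` times the flux into the segment. -/
theorem mul_stripProb_le {N R : ℕ} (h : N < R) {a b : ℤ} {k : ℕ} (hk : a.natAbs + 2 * k < N) :
    k * stripProb N R a b ≤ 2 * b.natAbs * segmentFlux N R := by
  have h1 : stripProb N R a b = stripProb N R a.natAbs b.natAbs := by
    obtain ha | ha := Int.natAbs_eq a <;> obtain hb | hb := Int.natAbs_eq b <;>
      (conv_lhs => rw [ha, hb]) <;> simp only [stripProb_neg_fst, stripProb_neg_snd]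
  rw [h1]
  obtain ⟨r, rfl⟩ : ∃ r, N = r + 1 := ⟨N - 1, by omega⟩
  have h2 := mul_stripProb_le_rowSum h a.natAbs k b.natAbs
  have h3 := rowSum_mono (r + 1) R b.natAbs (show a.natAbs + 2 * k ≤ r by omega)
  have h4 := rowSum_mono (r + 1) R b.natAbs (Nat.le_succ r)
  have h5 := rowSum_add_rowSum_le h le_rfl b.natAbs
  have h6 := rowSum_mono (r + 1) R 1 (Nat.le_succ r)
  have h7 := rowSum_one_le (r + 1) R
  have h8 : (b.natAbs : ℝ) * (rowSum (r + 1) R r 1 + rowSum (r + 1) R (r + 1) 1) ≤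
      b.natAbs * (8 * segmentFlux (r + 1) R) :=
    mul_le_mul_of_nonneg_left (by simp only [Nat.succ_eq_add_one] at h6; linarith)
      (Nat.cast_nonneg _)
  simp only [Nat.succ_eq_add_one] at h3 h4
  linarith

/-! ### First visits of the random walk -/

theorem stepLaw_singleton {t : Vertex} (ht : t ∈ unitSteps) : stepLaw {t} = 4⁻¹ := by
  rw [stepLaw, PMF.toMeasure_apply_singleton _ _ (measurableSet_singleton t),
    PMF.uniformOfFinset_apply_of_mem _ ht, card_unitSteps]
  rfl

theorem stepLaw_compl_unitSteps : stepLaw (unitSteps : Set Vertex)ᶜ = 0 := by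
  rw [stepLaw, PMF.toMeasure_apply_eq_zero_iff _ MeasurableSet.of_discrete,
    PMF.support_uniformOfFinset]
  exact disjoint_compl_right

theorem stepsLaw_preimage_eval (k : ℕ) (T : Set Vertex) :
    stepsLaw {ξ | ξ k ∈ T} = stepLaw T := by
  rw [← Measure.infinitePi_map_eval (fun _ : ℕ => stepLaw) k,
    Measure.map_apply (measurable_pi_apply k) MeasurableSet.of_discrete]
  rfl

/-- An event that is determined by the first `k` steps is independent of the next one. -/
theorem stepsLaw_inter_eval (k : ℕ) {V : Set (ℕ → Vertex)}
    (hV : ∀ ξ ξ', (∀ i < k, ξ i = ξ' i) → ξ ∈ V → ξ' ∈ V) (T : Set Vertex) :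
    stepsLaw (V ∩ {ξ | ξ k ∈ T}) = stepsLaw V * stepLaw T := by
  have hind : ProbabilityTheory.iIndepFun (fun (i : ℕ) (ξ : ℕ → Vertex) => ξ i) stepsLaw :=
    ProbabilityTheory.iIndepFun_infinitePi (X := fun _ => id) fun _ => measurable_id
  have h := hind.indepFun_finset (Finset.range k) {k} (by simp) fun i => measurable_pi_apply i
  have hV' : V = (fun ξ (i : Finset.range k) => ξ i) ⁻¹'
      ((fun ξ (i : Finset.range k) => ξ i) '' V) := by
    refine (Set.subset_preimage_image _ _).antisymm ?_
    rintro ξ ⟨ξ', hξ', he⟩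
    exact hV ξ' ξ (fun i hi => congrFun he ⟨i, Finset.mem_range.2 hi⟩) hξ'
  have hT : {ξ : ℕ → Vertex | ξ k ∈ T} = (fun ξ (i : ({k} : Finset ℕ)) => ξ i) ⁻¹'
      {c | c ⟨k, Finset.mem_singleton_self k⟩ ∈ T} := rfl
  rw [← stepsLaw_preimage_eval k T, hT, hV']
  exact h.measure_inter_preimage_eq_mul _ _ MeasurableSet.of_discrete MeasurableSet.of_discrete

/-- The probability that the walk started at `z` is at `y` at time `k` and has not been in `E`
before. -/
noncomputable def visitProb (E : Set Vertex) (z : Vertex) (k : ℕ) (y : Vertex) : ℝ≥0∞ :=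
  stepsLaw {ξ | walk z ξ k = y ∧ ∀ j < k, walk z ξ j ∉ E}

theorem walk_congr {z : Vertex} {ξ ξ' : ℕ → Vertex} {k : ℕ} (h : ∀ i < k, ξ i = ξ' i) :
    walk z ξ k = walk z ξ' k := by
  rw [walk, walk, Finset.sum_congr rfl fun i hi => h i (Finset.mem_range.1 hi)]

theorem walk_succ (z : Vertex) (ξ : ℕ → Vertex) (k : ℕ) : walk z ξ (k + 1) = walk z ξ k + ξ k := by
  rw [walk, walk, Finset.sum_range_succ, add_assoc]

/-- The forward equation for the walk killed when it leaves a point of `E`. -/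
theorem visitProb_succ_le (E : Set Vertex) (z : Vertex) (k : ℕ) (y : Vertex) :
    visitProb E z (k + 1) y ≤ avg (Eᶜ.indicator (visitProb E z k)) y := by
  classical
  set V : Vertex → Set (ℕ → Vertex) := fun s =>
    {ξ | y + s ∉ E ∧ walk z ξ k = y + s ∧ ∀ j < k, walk z ξ j ∉ E} with hVdef
  have hV : ∀ s ξ ξ', (∀ i < k, ξ i = ξ' i) → ξ ∈ V s → ξ' ∈ V s := by
    rintro s ξ ξ' h ⟨h1, h2, h3⟩
    refine ⟨h1, (walk_congr h).symm.trans h2, fun j hj => ?_⟩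
    rw [← walk_congr fun i hi => h i (hi.trans hj)]
    exact h3 j hj
  have hsub : {ξ | walk z ξ (k + 1) = y ∧ ∀ j < k + 1, walk z ξ j ∉ E} ⊆
      (⋃ s ∈ unitSteps, V s ∩ {ξ | ξ k ∈ ({-s} : Set Vertex)}) ∪
        {ξ | ξ k ∈ (unitSteps : Set Vertex)ᶜ} := by
    rintro ξ ⟨h1, h2⟩
    by_cases hk : ξ k ∈ unitSteps
    · rw [walk_succ] at h1
      have h3 : walk z ξ k = y + -ξ k := by rw [← h1]; abel
      refine Or.inl (Set.mem_biUnion (x := -ξ k) (neg_mem_unitSteps.2 hk) ⟨⟨?_, h3, ?_⟩, ?_⟩)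
      · rw [← h3]
        exact h2 k (Nat.lt_succ_self k)
      · exact fun j hj => h2 j (Nat.lt_succ_of_lt hj)
      · simp
    · exact Or.inr hk
  calc visitProb E z (k + 1) y
      ≤ stepsLaw (⋃ s ∈ unitSteps, V s ∩ {ξ | ξ k ∈ ({-s} : Set Vertex)}) +
          stepsLaw {ξ | ξ k ∈ (unitSteps : Set Vertex)ᶜ} :=
        (measure_mono hsub).trans (measure_union_le _ _)
    _ ≤ ∑ s ∈ unitSteps, stepsLaw (V s ∩ {ξ | ξ k ∈ ({-s} : Set Vertex)}) := by
        rw [stepsLaw_preimage_eval, stepLaw_compl_unitSteps, add_zero]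
        exact measure_biUnion_finset_le _ _
    _ = avg (Eᶜ.indicator (visitProb E z k)) y := by
        rw [avg, ENNReal.div_eq_inv_mul, mul_comm, Finset.sum_mul]
        refine Finset.sum_congr rfl fun s hs => ?_
        rw [stepsLaw_inter_eval k (hV s), stepLaw_singleton (neg_mem_unitSteps.2 hs)]
        congr 1
        by_cases h : y + s ∈ E
        · simp [hVdef, h]
        · simp [hVdef, h, visitProb]

/-- The transition operator of the walk killed on `E`. -/
noncomputable def killedAvg (E : Set Vertex) (f : Vertex → ℝ≥0∞) : Vertex → ℝ≥0∞ :=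
  Eᶜ.indicator (avg f)

theorem tsum_mul_visitProb_le (E : Set Vertex) (z : Vertex) (k : ℕ) (f : Vertex → ℝ≥0∞) :
    ∑' y, f y * visitProb E z k y ≤ (killedAvg E)^[k] f z := by
  induction k generalizing f with
  | zero =>
    rw [tsum_eq_single z]
    · exact mul_le_of_le_one_right zero_le prob_le_one
    · intro y hy
      simp [visitProb, walk, hy.symm]
  | succ k ih =>
    refine (ENNReal.tsum_le_tsum fun y => mul_le_mul_right (visitProb_succ_le E z k y) _).trans ?_
    rw [tsum_mul_avg, ← tsum_indicator_mul, Function.iterate_succ_apply]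
    exact ih _

/-- A function that dominates `f` plus its own killed average dominates the killed Green
potential of `f`. -/
theorem sum_killedAvg_le {E : Set Vertex} {f g : Vertex → ℝ≥0∞} (h : f + killedAvg E g ≤ g)
    (n : ℕ) : ∑ k ∈ Finset.range n, (killedAvg E)^[k] f ≤ g := by
  have hadd : ∀ u v, killedAvg E (u + v) = killedAvg E u + killedAvg E v := fun u v => by
    rw [killedAvg, avg_add, indicator_add_pi]; rfl
  have hsum : ∀ n : ℕ, killedAvg E (∑ k ∈ Finset.range n, (killedAvg E)^[k] f) =
      ∑ k ∈ Finset.range n, (killedAvg E)^[k + 1] f := by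
    intro n
    induction n with
    | zero => simp [killedAvg]
    | succ n ih => rw [Finset.sum_range_succ, hadd, ih, Finset.sum_range_succ,
        Function.iterate_succ_apply']
  induction n with
  | zero => exact fun _ => zero_le
  | succ n ih =>
    rw [Finset.sum_range_succ', ← hsum, add_comm]
    exact (add_le_add le_rfl fun x => Set.indicator_le_indicator (avg_mono ih x)).trans h

/-- The Green function of the complement of `D`. -/
noncomputable def greenFun (D : Set Vertex) (x z : Vertex) : ℝ≥0∞ := ⨆ n, green D (delta x) n z

theorem avg_greenFun_le {D : Set Vertex} (x : Vertex) {z : Vertex} (hz : z ∉ D) :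
    avg (greenFun D x) z ≤ greenFun D x z := by
  have : avg (greenFun D x) z = ⨆ n, avg (green D (delta x) n) z := avg_iSup (green_mono D _) z
  rw [this]
  refine iSup_le fun n => le_iSup_of_le (n + 1) ?_
  rw [green, Set.indicator_of_mem (by simpa using hz)]
  exact le_add_self

theorem exists_first_visit {D A : Set Vertex} (hDA : D ⊆ A) {e : DirEdge} {s : ℕ → Vertex}
    (h0 : s 0 ∉ D) (hs : s ∈ hitEvent A e) :
    ∃ k, s k = e.1 ∧ ∀ j < k, s j ∉ D ∪ {e.1} := by
  classical
  obtain ⟨n, hA, -, hn⟩ := hs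
  have hex : ∃ k, s k = e.1 := ⟨n - 1, hn⟩
  refine ⟨Nat.find hex, Nat.find_spec hex, fun j hj => ?_⟩
  have hj' : j < n - 1 := hj.trans_le (Nat.find_min' hex hn)
  rintro (hD | he)
  · obtain rfl | h1 := Nat.eq_zero_or_pos j
    · exact h0 hD
    · have := hA.2 ⟨h1, hDA hD⟩
      omega
  · exact Nat.find_min hex hj he

/-- The probability of an edge `e` being the one through which `A ⊇ D` is hit, times the Green
function on the diagonal at the starting point of `e`, is at most the Green function. -/
theorem greenFun_mul_walkLaw_hitEvent_le {D A : Set Vertex} (hDA : D ⊆ A) {e : DirEdge}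
    {z : Vertex} (hz : z ∉ D) :
    greenFun D e.1 e.1 * walkLaw z (hitEvent A e) ≤ greenFun D e.1 z := by
  set x := e.1
  set c := greenFun D x x
  have h1 : walkLaw z (hitEvent A e) ≤ ∑' k, visitProb (D ∪ {x}) z k x := by
    rw [walkLaw, Measure.map_apply (measurable_walk z) (measurableSet_hitEvent A e)]
    refine (measure_mono fun ξ hξ => ?_).trans (measure_iUnion_le _)
    obtain ⟨k, hk⟩ := exists_first_visit hDA (by simpa [walk] using hz) hξ
    exact Set.mem_iUnion.2 ⟨k, hk⟩
  have h2 : (fun y => c * delta x y) + killedAvg (D ∪ {x}) (greenFun D x) ≤ greenFun D x := by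
    intro y
    by_cases hy : y = x
    · subst hy
      simp [killedAvg, c]
    · by_cases hD : y ∈ D
      · simp [killedAvg, hD, delta_of_ne hy]
      · simpa [killedAvg, hD, delta_of_ne hy, hy] using avg_greenFun_le x hD
  refine (mul_le_mul_right h1 c).trans ?_
  rw [← ENNReal.tsum_mul_left, ENNReal.tsum_eq_iSup_nat]
  refine iSup_le fun n => ?_
  refine le_trans ?_ (sum_killedAvg_le h2 n z)
  rw [Finset.sum_apply]
  refine Finset.sum_le_sum fun k _ => ?_
  refine le_trans (le_of_eq ?_) (tsum_mul_visitProb_le (D ∪ {x}) z k fun y => c * delta x y)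
  rw [← tsum_delta_mul x (visitProb (D ∪ {x}) z k), ← ENNReal.tsum_mul_left]
  simp only [mul_assoc]

/-! ### The Green function on the diagonal -/

open scoped Classical in
/-- The law at time `k` of simple random walk on `ℤ` started at the origin. -/
noncomputable def lineLaw : ℕ → ℤ → ℝ≥0∞
  | 0 => fun j => if j = 0 then 1 else 0
  | k + 1 => fun j => (lineLaw k (j + 1) + lineLaw k (j - 1)) / 2

theorem choose_div_le_lineLaw (k j : ℕ) :
    (k.choose j : ℝ≥0∞) / 2 ^ k ≤ lineLaw k (2 * j - k) := by
  induction k generalizing j with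
  | zero =>
    cases j <;> simp [lineLaw]
  | succ k ih =>
    have h2 : ∀ a : ℝ≥0∞, a / 2 ^ (k + 1) = a / 2 ^ k / 2 := fun a => by
      rw [pow_succ, ENNReal.div_eq_inv_mul, ENNReal.mul_inv (by simp) (by simp),
        ENNReal.div_eq_inv_mul, ENNReal.div_eq_inv_mul]
      ring
    rw [h2]
    refine ENNReal.div_le_div_right ?_ _
    cases j with
    | zero =>
      have := ih 0
      refine le_add_right ?_
      simpa using this
    | succ j =>
      rw [Nat.choose_succ_succ, Nat.cast_add, ENNReal.add_div, add_comm]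
      refine add_le_add ?_ ?_
      · refine (ih (j + 1)).trans_eq (congrArg _ ?_)
        omega
      · refine (ih j).trans_eq (congrArg _ ?_)
        omega

/-- In the coordinates `x + y` and `x - y` the two-dimensional walk is a pair of independent
one-dimensional walks. -/
theorem avg_lineLaw_mul_lineLaw (k : ℕ) (x : Vertex) :
    avg (fun y => lineLaw k (y.1 - x.1 + (y.2 - x.2)) * lineLaw k (y.1 - x.1 - (y.2 - x.2))) =
      fun y => lineLaw (k + 1) (y.1 - x.1 + (y.2 - x.2)) *
        lineLaw (k + 1) (y.1 - x.1 - (y.2 - x.2)) := by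
  funext ⟨a, b⟩
  rw [avg_apply]
  simp only [lineLaw]
  rw [show a + 1 - x.1 + (b - x.2) = a - x.1 + (b - x.2) + 1 by ring,
    show a + 1 - x.1 - (b - x.2) = a - x.1 - (b - x.2) + 1 by ring,
    show a - 1 - x.1 + (b - x.2) = a - x.1 + (b - x.2) - 1 by ring,
    show a - 1 - x.1 - (b - x.2) = a - x.1 - (b - x.2) - 1 by ring,
    show a - x.1 + (b + 1 - x.2) = a - x.1 + (b - x.2) + 1 by ring,
    show a - x.1 - (b + 1 - x.2) = a - x.1 - (b - x.2) - 1 by ring,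
    show a - x.1 + (b - 1 - x.2) = a - x.1 + (b - x.2) - 1 by ring,
    show a - x.1 - (b - 1 - x.2) = a - x.1 - (b - x.2) + 1 by ring]
  have h4 : (4 : ℝ≥0∞)⁻¹ = 2⁻¹ * 2⁻¹ := by
    rw [← ENNReal.mul_inv (by simp) (by simp)]
    norm_num
  simp only [ENNReal.div_eq_inv_mul, h4]
  ring

/-- The expected number of visits to the starting point before time `n`. -/
noncomputable def returnSum (n : ℕ) : ℝ≥0∞ := ∑ k ∈ Finset.range n, lineLaw k 0 ^ 2

theorem avg_sum (n : ℕ) (f : ℕ → Vertex → ℝ≥0∞) :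
    avg (∑ k ∈ Finset.range n, f k) = ∑ k ∈ Finset.range n, avg (f k) := by
  induction n with
  | zero => simp
  | succ n ih => rw [Finset.sum_range_succ, avg_add, ih, Finset.sum_range_succ]

theorem green_empty_delta (x : Vertex) (n : ℕ) : green ∅ (delta x) n =
    ∑ k ∈ Finset.range n, fun y => lineLaw k (y.1 - x.1 + (y.2 - x.2)) *
      lineLaw k (y.1 - x.1 - (y.2 - x.2)) := by
  induction n with
  | zero => simp [green]
  | succ n ih =>
    rw [green, ih, avg_sum, Finset.sum_range_succ', Set.compl_empty, Set.indicator_univ, add_comm]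
    simp only [avg_lineLaw_mul_lineLaw]
    congr 1
    funext y
    by_cases hy : y = x
    · simp [hy, lineLaw]
    · have : ¬ (y.1 - x.1 + (y.2 - x.2) = 0 ∧ y.1 - x.1 - (y.2 - x.2) = 0) := fun h =>
        hy (Prod.ext (by omega) (by omega))
      rw [delta_of_ne hy]
      simp only [lineLaw]
      split_ifs <;> simp_all

/-- The walk needs `n` steps to reach a set that is contained in the axis from height `n`. -/
theorem green_eq_green_empty {D : Set Vertex} (hD : ∀ x ∈ D, x.2 = 0) (f : Vertex → ℝ≥0∞) (n : ℕ)
    {x : Vertex} (hx : n ≤ x.2.natAbs) : green D f n x = green ∅ f n x := by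
  induction n generalizing x with
  | zero => rfl
  | succ n ih =>
    rw [green, green, Set.indicator_of_mem, Set.indicator_of_mem, Pi.add_apply, Pi.add_apply, avg,
      avg]
    · congr 2
      refine Finset.sum_congr rfl fun s hs => ih ?_
      simp only [unitSteps, Finset.mem_insert, Finset.mem_singleton] at hs
      rcases hs with rfl | rfl | rfl | rfl <;> simp only [Prod.snd_add] <;> omega
    · simp
    · intro h
      have := hD x h
      omega

theorem returnSum_le_greenFun {D : Set Vertex} (hD : ∀ x ∈ D, x.2 = 0) (x : Vertex) :
    returnSum x.2.natAbs ≤ greenFun D x x := by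
  refine le_trans (le_of_eq ?_) (le_iSup (fun n => green D (delta x) n x) x.2.natAbs)
  rw [green_eq_green_empty hD _ _ le_rfl, green_empty_delta, Finset.sum_apply, returnSum]
  simp [sq]

theorem one_le_returnSum {n : ℕ} (hn : 0 < n) : 1 ≤ returnSum n := by
  refine le_trans (le_of_eq ?_) (Finset.single_le_sum (f := fun k => lineLaw k 0 ^ 2)
    (fun _ _ => zero_le) (Finset.mem_range.2 hn))
  simp [lineLaw]

theorem sixteen_pow_le (n : ℕ) : 16 ^ (n + 1) ≤ (n + 1).centralBinom ^ 2 * (4 * (n + 1)) := by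
  induction n with
  | zero => simp [Nat.centralBinom, Nat.choose]
  | succ n ih =>
    have h := Nat.succ_mul_centralBinom_succ (n + 1)
    refine Nat.le_of_mul_le_mul_left ?_ (show 0 < (n + 2) ^ 2 by positivity)
    calc (n + 2) ^ 2 * 16 ^ (n + 1 + 1)
        = 16 * (n + 2) ^ 2 * 16 ^ (n + 1) := by ring
      _ ≤ 16 * (n + 2) ^ 2 * ((n + 1).centralBinom ^ 2 * (4 * (n + 1))) :=
          Nat.mul_le_mul_left _ ih
      _ = 16 * (n + 2) * (n + 1).centralBinom ^ 2 * (4 * (n + 1) * (n + 2)) := by ring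
      _ ≤ 16 * (n + 2) * (n + 1).centralBinom ^ 2 * (2 * (n + 1) + 1) ^ 2 :=
          Nat.mul_le_mul_left _ (by nlinarith)
      _ = (2 * (2 * (n + 1) + 1) * (n + 1).centralBinom) ^ 2 * (4 * (n + 2)) := by ring
      _ = ((n + 1 + 1) * (n + 1 + 1).centralBinom) ^ 2 * (4 * (n + 2)) := by rw [← h]
      _ = _ := by ring

theorem inv_le_lineLaw_sq (i : ℕ) :
    ENNReal.ofReal (1 / (4 * (i + 1))) ≤ lineLaw (2 * (i + 1)) 0 ^ 2 := by
  have h := choose_div_le_lineLaw (2 * (i + 1)) (i + 1)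
  rw [show (2 * ((i + 1 : ℕ) : ℤ) - (2 * (i + 1) : ℕ)) = 0 by push_cast; ring] at h
  refine le_trans ?_ (pow_le_pow_left₀ zero_le h 2)
  have h2 : ((2 * (i + 1)).choose (i + 1) : ℝ≥0∞) / 2 ^ (2 * (i + 1)) =
      ENNReal.ofReal ((i + 1).centralBinom / 2 ^ (2 * (i + 1))) := by
    rw [ENNReal.ofReal_div_of_pos (by positivity), ENNReal.ofReal_natCast,
      ENNReal.ofReal_pow (by norm_num)]
    simp [Nat.centralBinom]
  rw [h2, ← ENNReal.ofReal_pow (by positivity)]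
  refine ENNReal.ofReal_le_ofReal ?_
  have h3 : (16 : ℝ) ^ (i + 1) ≤ ((i + 1).centralBinom : ℝ) ^ 2 * (4 * (i + 1)) := by
    exact_mod_cast sixteen_pow_le i
  rw [div_pow, ← pow_mul, show 2 * (i + 1) * 2 = 4 * (i + 1) by ring, pow_mul,
    show (2 : ℝ) ^ 4 = 16 by norm_num, div_le_div_iff₀ (by positivity) (by positivity), one_mul]
  exact h3

/-- Recurrence of the planar walk: the expected number of returns is infinite. -/
theorem tendsto_returnSum : Tendsto returnSum atTop (nhds ∞) := by
  have h : ∑' k, lineLaw k 0 ^ 2 = ∞ := by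
    by_contra hne
    have hinj : Function.Injective fun i : ℕ => 2 * (i + 1) := fun i j hij => by
      simp only at hij
      omega
    have h1 : ∑' i : ℕ, ENNReal.ofReal (1 / (4 * (i + 1))) ≠ ∞ :=
      ne_top_of_le_ne_top hne ((ENNReal.tsum_le_tsum inv_le_lineLaw_sq).trans
        (ENNReal.tsum_comp_le_tsum_of_injective hinj fun k => lineLaw k 0 ^ 2))
    have h2 := (ENNReal.summable_toReal h1).mul_left 4
    refine Real.not_summable_one_div_natCast ((summable_nat_add_iff 1).1 ?_)
    refine h2.congr fun i => ?_
    rw [ENNReal.toReal_ofReal (by positivity)]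
    push_cast
    field_simp
  rw [← h]
  exact ENNReal.tendsto_nat_tsum _

/-! ### Upper bound for the edge harmonic measure -/

theorem eventually_cobounded {p : Vertex → Prop} (h : ∀ᶠ z in Bornology.cobounded Vertex, p z)
    (N : ℕ) : ∃ R : ℕ, N < R ∧ ∀ z ∈ farSet R, p z := by
  rw [(Metric.hasBasis_cobounded_compl_closedBall (0 : Vertex)).eventually_iff] at h
  obtain ⟨r, -, hr⟩ := h
  refine ⟨max (N + 1) (⌈r⌉₊ + 1), by simp, fun z hz => hr ?_⟩
  rw [Set.mem_compl_iff, Metric.mem_closedBall, not_le, dist_zero_right]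
  have h1 : (⌈r⌉₊ : ℤ) + 1 ≤ |z.1| := le_trans (by push_cast; exact le_max_right _ _) hz
  have h2 : (⌈r⌉₊ : ℝ) + 1 ≤ |(z.1 : ℝ)| := by exact_mod_cast h1
  have h3 : |(z.1 : ℝ)| ≤ ‖z‖ := by simpa [Int.norm_eq_abs] using norm_fst_le z
  linarith [Nat.le_ceil r]

/-- The edge harmonic measure of an edge that starts at height `h ≠ 0` above a point of the
segment at distance more than `2k` from its ends is at most `2h / (k c)` for every lower bound `c`
for the number of returns to the starting point. -/
theorem edgeHarm_le {N k : ℕ} {A : Set Vertex} (hA : (segment N : Set Vertex) ⊆ A) {e : DirEdge}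
    (hk : e.1.1.natAbs + 2 * k < N) (hk0 : 0 < k) {c : ℝ} (hc0 : 0 < c)
    (hc : ENNReal.ofReal c ≤ returnSum e.1.2.natAbs) :
    edgeHarm A e ≤ ENNReal.ofReal (2 * e.1.2.natAbs / (k * c)) := by
  refine le_of_forall_lt fun w hw => ?_
  obtain ⟨w', hw', hw2⟩ := exists_between hw
  refine hw'.trans_le ?_
  have hfin : w' ≠ ∞ := hw2.ne_top
  obtain ⟨R, hNR, hR⟩ := eventually_cobounded (eventually_lt_of_lt_liminf hw2) N
  have hdisj := disjoint_segment_farSet hNR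
  have hG : ENNReal.ofReal c ≤ greenFun (segment N) e.1 e.1 :=
    hc.trans (returnSum_le_greenFun (fun x hx => (mem_segment.1 (Finset.mem_coe.1 hx)).2) e.1)
  have h1 := mul_flux_reachProb_le (segment N) hdisj e.1 (c := ENNReal.ofReal c * w')
    fun z hz => (mul_le_mul' hG (hR z hz).le).trans
      (greenFun_mul_walkLaw_hitEvent_le hA (Set.disjoint_right.1 hdisj hz))
  have h2 := ENNReal.toReal_mono (reachProb_ne_top _ _ _) h1
  rw [ENNReal.toReal_mul, ENNReal.toReal_mul, ENNReal.toReal_ofReal hc0.le] at h2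
  have h3 := mul_stripProb_le hNR hk (b := e.1.2)
  have h4 : c * w'.toReal * segmentFlux N R ≤ stripProb N R e.1.1 e.1.2 := h2
  have h5 := segmentFlux_pos hNR
  rw [ENNReal.le_ofReal_iff_toReal_le hfin (by positivity), le_div_iff₀ (by positivity)]
  refine le_of_mul_le_mul_right ?_ h5
  calc w'.toReal * (k * c) * segmentFlux N R = k * (c * w'.toReal * segmentFlux N R) := by ring
    _ ≤ k * stripProb N R e.1.1 e.1.2 := mul_le_mul_of_nonneg_left h4 (Nat.cast_nonneg k)
    _ ≤ _ := h3

/-- No edge that starts in the target set is ever used. -/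
theorem edgeHarm_eq_zero {A : Set Vertex} {e : DirEdge} (he : e.1 ∈ A) : edgeHarm A e = 0 := by
  refine le_antisymm ?_ zero_le
  refine liminf_le_of_frequently_le' (Eventually.frequently ?_)
  have h : ∀ᶠ z in Bornology.cobounded Vertex, z ≠ e.1 :=
    Bornology.isBounded_def.1 Bornology.isBounded_singleton
  filter_upwards [h] with z hz
  rw [walkLaw, Measure.map_apply (measurable_walk z) (measurableSet_hitEvent A e)]
  refine (le_of_eq ?_ : _ ≤ (0 : ℝ≥0∞))
  convert measure_empty (μ := stepsLaw)
  refine Set.eq_empty_of_forall_notMem ?_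
  rintro ξ ⟨n, hn, -, h1⟩
  have hn1 : 1 ≤ n := hn.1.1
  obtain h0 | h0 := Nat.eq_zero_or_pos (n - 1)
  · rw [h0] at h1
    exact hz (by simpa [walk] using h1)
  · have := hn.2 (show 1 ≤ n - 1 ∧ walk z ξ (n - 1) ∈ A from ⟨h0, h1 ▸ he⟩)
    omega

/-! ### Growth of the process along chains of edges -/

/-- `Chain m G i v`: there is a directed path of `i` edges of `G` from `v` to the segment
`D_m`. -/
def Chain (m : ℕ) (G : State) : ℕ → Vertex → Prop
  | 0, v => v ∈ segment m
  | i + 1, v => ∃ u, (v, u) ∈ G.2 ∧ Chain m G i u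

/-- The invariant of the process: edges are lattice edges between vertices of the state, and
every vertex is joined to the segment `D_m` by a chain of edges. -/
structure Valid (m : ℕ) (G : State) : Prop where
  edge : ∀ e ∈ G.2, Adj e.1 e.2 ∧ e.1 ∈ G.1 ∧ e.2 ∈ G.1
  chain : ∀ v ∈ G.1, ∃ i, Chain m G i v

theorem Chain.addEdge {m : ℕ} {G : State} {i : ℕ} {v : Vertex} (h : Chain m G i v) (e : DirEdge) :
    Chain m (G.addEdge e) i v := by
  induction i generalizing v with
  | zero => exact h
  | succ i ih =>
    obtain ⟨u, hu, hc⟩ := h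
    exact ⟨u, Finset.mem_insert_of_mem hu, ih hc⟩

theorem adj_iff_exists_unitStep {x y : Vertex} : Adj x y ↔ ∃ s ∈ unitSteps, y = x + s := by
  constructor
  · intro h
    refine ⟨y - x, ?_, by abel⟩
    rw [Adj] at h
    have h1 : -1 ≤ x.1 - y.1 ∧ x.1 - y.1 ≤ 1 := by constructor <;> nlinarith [sq_nonneg (x.2 - y.2)]
    have h2 : -1 ≤ x.2 - y.2 ∧ x.2 - y.2 ≤ 1 := by constructor <;> nlinarith [sq_nonneg (x.1 - y.1)]
    simp only [unitSteps, Finset.mem_insert, Finset.mem_singleton, Prod.ext_iff, Prod.fst_sub,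
      Prod.snd_sub]
    obtain h3 | h3 | h3 : x.1 - y.1 = -1 ∨ x.1 - y.1 = 0 ∨ x.1 - y.1 = 1 := by omega
    all_goals
      obtain h4 | h4 | h4 : x.2 - y.2 = -1 ∨ x.2 - y.2 = 0 ∨ x.2 - y.2 = 1 := by omega
      all_goals
        rw [h3, h4] at h
        omega
  · rintro ⟨s, hs, rfl⟩
    simp only [unitSteps, Finset.mem_insert, Finset.mem_singleton] at hs
    rcases hs with rfl | rfl | rfl | rfl <;> simp [Adj]

theorem Valid.addEdge {m : ℕ} {G : State} (hG : Valid m G) {e : DirEdge}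
    (he : e ∈ edgeBoundary (G.1 : Set Vertex)) : Valid m (G.addEdge e) := by
  obtain ⟨hadj, -, h2, -⟩ := he
  constructor
  · intro f hf
    obtain rfl | hf := Finset.mem_insert.1 hf
    · exact ⟨hadj, Finset.mem_insert_self _ _, Finset.mem_insert_of_mem h2⟩
    · obtain ⟨h, h', h''⟩ := hG.edge f hf
      exact ⟨h, Finset.mem_insert_of_mem h', Finset.mem_insert_of_mem h''⟩
  · intro v hv
    obtain rfl | hv := Finset.mem_insert.1 hv
    · obtain ⟨i, hi⟩ := hG.chain e.2 h2
      exact ⟨i + 1, e.2, Finset.mem_insert_self _ _, hi.addEdge e⟩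
    · obtain ⟨i, hi⟩ := hG.chain v hv
      exact ⟨i, hi.addEdge e⟩

/-- Adding an edge can only create chains that begin with this edge, since its starting point is
a new vertex. -/
theorem Chain.of_addEdge {m : ℕ} {G : State} (hG : Valid m G) {e : DirEdge}
    (he : e ∈ edgeBoundary (G.1 : Set Vertex)) {i : ℕ} {v : Vertex}
    (h : Chain m (G.addEdge e) (i + 1) v) :
    Chain m G (i + 1) v ∨ ∃ u, e = (v, u) ∧ Chain m G i u := by
  obtain ⟨-, ⟨h1, -⟩, h2, -⟩ := he
  induction i generalizing v with
  | zero =>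
    obtain ⟨u, hu, hc⟩ := h
    obtain hu | hu := Finset.mem_insert.1 hu
    · exact Or.inr ⟨u, hu.symm, hc⟩
    · exact Or.inl ⟨u, hu, hc⟩
  | succ i ih =>
    obtain ⟨u, hu, hc⟩ := h
    have hue : u ≠ e.1 := by
      rintro rfl
      obtain hu | hu := Finset.mem_insert.1 hu
      · have h3 : e.2 = e.1 := (congrArg Prod.snd hu).symm
        exact h1 (h3 ▸ h2)
      · exact h1 (hG.edge _ hu).2.2
    have hc' : Chain m G (i + 1) u := by
      obtain h | ⟨w, hw, -⟩ := ih hc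
      · exact h
      · exact absurd (by rw [hw]) hue
    obtain hu | hu := Finset.mem_insert.1 hu
    · exact Or.inr ⟨u, hu.symm, hc'⟩
    · exact Or.inl ⟨u, hu, hc'⟩

theorem Chain.abs_le {m : ℕ} {G : State} (hG : Valid m G) {i : ℕ} {v : Vertex}
    (h : Chain m G i v) : |v.1| ≤ m + i ∧ |v.2| ≤ i := by
  induction i generalizing v with
  | zero =>
    obtain ⟨h1, h2⟩ := mem_segment.1 h
    simpa [h2] using h1
  | succ i ih =>
    obtain ⟨u, hu, hc⟩ := h
    obtain ⟨h1, h2⟩ := ih hc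
    obtain ⟨s, hs, rfl⟩ : ∃ s ∈ unitSteps, u = v + s :=
      adj_iff_exists_unitStep.1 (hG.edge _ hu).1
    simp only [Prod.fst_add, Prod.snd_add] at h1 h2
    simp only [unitSteps, Finset.mem_insert, Finset.mem_singleton] at hs
    rw [_root_.abs_le] at *
    rw [_root_.abs_le] at *
    push_cast
    rcases hs with rfl | rfl | rfl | rfl <;> simp only at h1 h2 ⊢ <;> omega

theorem Chain.exists_of_le {m : ℕ} {G : State} {i j : ℕ} (hij : i ≤ j) {v : Vertex}
    (h : Chain m G j v) : ∃ u, Chain m G i u := by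
  induction j, hij using Nat.le_induction generalizing v with
  | base => exact ⟨v, h⟩
  | succ j _ ih =>
    obtain ⟨u, -, hc⟩ := h
    exact ih hc

theorem mem_edgeBoundary_of_choice_ne_zero {N : ℕ} {G : State} {e : DirEdge}
    (h : choice N G (some e) ≠ 0) : e ∈ edgeBoundary (G.1 : Set Vertex) := by
  by_contra he
  exact h (if_neg he)

theorem choice_some (N : ℕ) (G : State) (e : DirEdge) : choice N G (some e) = edgeProb N G e := rfl

theorem valid_of_law_ne_zero {m N k : ℕ} {G : State} (h : law m N k G ≠ 0) : Valid m G := by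
  induction k generalizing G with
  | zero =>
    obtain rfl : G = (segment m, ∅) := by
      by_contra hne
      exact h (by rw [law, PMF.pure_apply, if_neg hne])
    exact ⟨by simp, fun v hv => ⟨0, hv⟩⟩
  | succ k ih =>
    rw [← PMF.mem_support_iff, law, PMF.mem_support_bind_iff] at h
    obtain ⟨G', hG', h⟩ := h
    rw [transition, PMF.mem_support_map_iff] at h
    obtain ⟨o, ho, rfl⟩ := h
    have hv := ih (G := G') hG'
    cases o with
    | none => exact hv
    | some e => exact hv.addEdge (mem_edgeBoundary_of_choice_ne_zero ho)

theorem toOuterMeasure_le_one {α : Type*} (p : PMF α) (s : Set α) : p.toOuterMeasure s ≤ 1 := by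
  rw [PMF.toOuterMeasure_apply]
  exact (ENNReal.tsum_le_tsum (Set.indicator_le_self' fun _ _ => zero_le)).trans
    (PMF.tsum_coe p).le

open scoped Classical in
theorem transition_chain_le {m N : ℕ} {G : State} (hG : Valid m G) {i : ℕ} {c : ℝ≥0∞}
    (hc : ∀ v u, Adj v u → Chain m G i u → edgeProb N G (v, u) ≤ c) (v : Vertex) :
    (transition N G).toOuterMeasure {G' | Chain m G' (i + 1) v} ≤
      (if Chain m G (i + 1) v then 1 else 0) +
        c * ∑ s ∈ unitSteps, if Chain m G i (v + s) then 1 else 0 := by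
  by_cases hv : Chain m G (i + 1) v
  · rw [if_pos hv]
    exact le_add_right (toOuterMeasure_le_one _ _)
  rw [if_neg hv, zero_add, transition, PMF.toOuterMeasure_map_apply]
  calc (choice N G).toOuterMeasure _
      ≤ (choice N G).toOuterMeasure
          (⋃ s ∈ unitSteps.filter fun s => Chain m G i (v + s), {some (v, v + s)}) := by
        refine PMF.toOuterMeasure_mono _ ?_
        rintro o ⟨ho, hs⟩
        cases o with
        | none => exact absurd ho hv
        | some e =>
          have he := mem_edgeBoundary_of_choice_ne_zero hs
          obtain h | ⟨u, rfl, hu⟩ := Chain.of_addEdge hG he ho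
          · exact absurd h hv
          · obtain ⟨s, hs', rfl⟩ : ∃ s ∈ unitSteps, u = v + s := adj_iff_exists_unitStep.1 he.1
            exact Set.mem_biUnion (Finset.mem_coe.2 (Finset.mem_filter.2 ⟨hs', hu⟩)) rfl
    _ ≤ ∑ s ∈ unitSteps.filter fun s => Chain m G i (v + s),
          (choice N G).toOuterMeasure {some (v, v + s)} := measure_biUnion_finset_le _ _
    _ ≤ _ := by
        rw [Finset.sum_filter, Finset.mul_sum]
        refine Finset.sum_le_sum fun s hs => ?_
        split_ifs with h
        · rw [PMF.toOuterMeasure_apply_singleton, choice_some, mul_one]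
          exact hc _ _ (adj_iff_exists_unitStep.2 ⟨s, hs, rfl⟩) h
        · exact zero_le

/-- The probability that a chain of length `i` leads from `v` to the segment at time `k`. -/
noncomputable def chainProb (m N k i : ℕ) (v : Vertex) : ℝ≥0∞ :=
  (law m N k).toOuterMeasure {G | Chain m G i v}

open scoped Classical in
theorem chainProb_eq (m N k i : ℕ) (v : Vertex) : chainProb m N k i v =
    ∑' G, law m N k G * if Chain m G i v then 1 else 0 := by
  rw [chainProb, PMF.toOuterMeasure_apply]
  refine tsum_congr fun G => ?_
  by_cases h : Chain m G i v <;> simp [h]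

/-- If all edges that prolong a chain of length `i` are chosen with probability at most `c`, then
the expected number of endpoints of chains of length `i + 1` grows in one step at most by `4 c`
times the expected number of endpoints of chains of length `i`. -/
theorem tsum_chainProb_succ_le {m N i : ℕ} {c : ℝ≥0∞}
    (hc : ∀ G, Valid m G → ∀ v u, Adj v u → Chain m G i u → edgeProb N G (v, u) ≤ c) (k : ℕ) :
    ∑' v, chainProb m N (k + 1) (i + 1) v ≤
      ∑' v, chainProb m N k (i + 1) v + 4 * c * ∑' v, chainProb m N k i v := by
  classical
  have h : ∀ v, chainProb m N (k + 1) (i + 1) v ≤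
      chainProb m N k (i + 1) v + 4 * c * avg (chainProb m N k i) v := by
    intro v
    have h4 : 4 * c * avg (chainProb m N k i) v =
        c * ∑ s ∈ unitSteps, chainProb m N k i (v + s) := by
      rw [avg, mul_comm 4 c, mul_assoc, ENNReal.mul_div_cancel (by simp) (by simp)]
    rw [h4, chainProb, law, PMF.toOuterMeasure_bind_apply]
    simp only [chainProb_eq]
    rw [← Summable.tsum_finsetSum fun _ _ => ENNReal.summable, ← ENNReal.tsum_mul_left,
      ← ENNReal.tsum_add]
    refine ENNReal.tsum_le_tsum fun G => ?_
    by_cases hG : law m N k G = 0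
    · simp [hG]
    · refine (mul_le_mul_right (transition_chain_le (valid_of_law_ne_zero hG)
        (hc G (valid_of_law_ne_zero hG)) v) _).trans_eq ?_
      rw [← Finset.mul_sum]
      ring
  refine (ENNReal.tsum_le_tsum h).trans_eq ?_
  rw [ENNReal.tsum_add, ENNReal.tsum_mul_left]
  have := tsum_mul_avg 1 (chainProb m N k i)
  simp only [avg_one, Pi.one_apply, one_mul] at this
  rw [this]

theorem card_segment (m : ℕ) : (segment m).card = 2 * m + 1 := by
  rw [segment, Finset.card_product, Int.card_Icc, Finset.card_singleton]
  omega

theorem tsum_chainProb_zero_le (m N k : ℕ) : ∑' v, chainProb m N k 0 v ≤ 2 * m + 1 := by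
  classical
  have h : ∀ v, chainProb m N k 0 v ≤ (segment m : Set Vertex).indicator 1 v := by
    intro v
    by_cases hv : v ∈ segment m
    · rw [Set.indicator_of_mem (Finset.mem_coe.2 hv)]
      exact toOuterMeasure_le_one _ _
    · refine le_trans (le_of_eq ?_) zero_le
      simp [chainProb_eq, Chain, hv]
  refine (ENNReal.tsum_le_tsum h).trans_eq ?_
  rw [← tsum_subtype, Finset.tsum_subtype']
  simp [card_segment]

/-- A bound for the expected number of endpoints of chains of length `i` at time `k`: `2m + 1`
roots, `4` directions for each edge, and `k.choose i` sets of times at which the edges are added. -/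
theorem tsum_chainProb_le {m N L : ℕ} {c : ℕ → ℝ≥0∞}
    (hc : ∀ i < L, ∀ G, Valid m G → ∀ v u, Adj v u → Chain m G i u → edgeProb N G (v, u) ≤ c i)
    (k : ℕ) {i : ℕ} (hi : i ≤ L) :
    ∑' v, chainProb m N k i v ≤
      (2 * m + 1) * (k.choose i * ∏ j ∈ Finset.range i, (4 * c j)) := by
  induction k generalizing i with
  | zero =>
    cases i with
    | zero => simpa using tsum_chainProb_zero_le m N 0
    | succ i =>
      refine le_trans (le_of_eq ?_) zero_le
      refine ENNReal.tsum_eq_zero.2 fun v => ?_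
      rw [chainProb, law, PMF.toOuterMeasure_pure_apply, if_neg]
      rintro ⟨u, hu, -⟩
      simp at hu
  | succ k ih =>
    cases i with
    | zero => simpa using tsum_chainProb_zero_le m N (k + 1)
    | succ i =>
      refine (tsum_chainProb_succ_le (hc i hi) k).trans ?_
      refine (add_le_add (ih hi) (mul_le_mul_right (ih (Nat.le_of_succ_le hi)) _)).trans_eq ?_
      rw [Nat.choose_succ_succ, Finset.prod_range_succ]
      push_cast
      ring

/-- A state that leaves the box contains a long chain. -/
theorem exists_chain_of_not_inside {m : ℕ} {G : State} (hG : Valid m G)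
    (h : ¬ G.Inside (thinBox m)) : ∃ v, Chain m G (⌊Real.log m⌋₊ + 1) v := by
  obtain ⟨v, hv, hvF⟩ : ∃ v ∈ G.1, v ∉ thinBox m := by
    by_contra! hall
    exact h ⟨hall, fun e he => ⟨(hG.edge e he).1, hall _ (hG.edge e he).2.1,
      hall _ (hG.edge e he).2.2⟩⟩
  obtain ⟨i, hi⟩ := hG.chain v hv
  obtain ⟨h1, h2⟩ := hi.abs_le hG
  have h1' : |(v.1 : ℝ)| ≤ m + i := by exact_mod_cast h1
  have h2' : |(v.2 : ℝ)| ≤ i := by exact_mod_cast h2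
  refine hi.exists_of_le (Nat.succ_le_of_lt ((Nat.floor_lt (Real.log_natCast_nonneg m)).2 ?_))
  exact lt_of_not_ge fun hle => hvF ⟨by linarith, by linarith⟩

theorem one_sub_le_probInside (m N k : ℕ) {p : ℝ} (hp : 0 ≤ p)
    (h : ∑' v, chainProb m N k (⌊Real.log m⌋₊ + 1) v ≤ ENNReal.ofReal p) :
    1 - p ≤ probInside m N k (thinBox m) := by
  have h1 : (law m N k).toOuterMeasure {G | G.Inside (thinBox m)}ᶜ ≤ ENNReal.ofReal p := by
    refine le_trans ?_ h
    refine le_trans (PMF.toOuterMeasure_mono (law m N k)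
      (t := ⋃ v, {G | Chain m G (⌊Real.log m⌋₊ + 1) v}) ?_) (measure_iUnion_le _)
    rintro G ⟨hG, hs⟩
    exact Set.mem_iUnion.2 (exists_chain_of_not_inside (valid_of_law_ne_zero hs) hG)
  have h2 : 1 ≤ (law m N k).toOuterMeasure {G | G.Inside (thinBox m)} + ENNReal.ofReal p := by
    refine le_trans ?_ (add_le_add le_rfl h1)
    refine le_trans (le_of_eq ?_) (measure_union_le _ _)
    rw [Set.union_compl_self]
    simp [PMF.toOuterMeasure_apply]
  have hfin : (law m N k).toOuterMeasure {G | G.Inside (thinBox m)} ≠ ∞ :=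
    ne_top_of_le_ne_top ENNReal.one_ne_top (toOuterMeasure_le_one _ _)
  have h3 := ENNReal.toReal_mono (ENNReal.add_ne_top.2 ⟨hfin, ENNReal.ofReal_ne_top⟩) h2
  rw [ENNReal.toReal_add hfin ENNReal.ofReal_ne_top, ENNReal.toReal_ofReal hp,
    ENNReal.toReal_one] at h3
  rw [probInside]
  linarith

/-! ### Sublinear growth of the rates -/

/-- Since the returns to the starting point accumulate, the bound `h / c` of `edgeHarm_le` grows
more slowly than `h`. -/
theorem exists_le_returnSum {η : ℝ} (hη : 0 < η) : ∃ K : ℕ, ∀ h : ℕ, 0 < h →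
    ∃ c : ℝ, 0 < c ∧ ENNReal.ofReal c ≤ returnSum h ∧ h / c ≤ η * (h + K) := by
  obtain ⟨n₀, hn₀⟩ := eventually_atTop.1
    (tendsto_returnSum.eventually (eventually_ge_nhds (ENNReal.ofReal_lt_top (r := 1 / η))))
  refine ⟨⌈n₀ / η⌉₊, fun h hh => ?_⟩
  obtain hle | hlt := le_or_gt n₀ h
  · refine ⟨1 / η, by positivity, hn₀ h hle, ?_⟩
    rw [div_div_eq_mul_div, div_one, mul_comm]
    exact mul_le_mul_of_nonneg_left (by simp) hη.le
  · refine ⟨1, one_pos, by simpa using one_le_returnSum hh, ?_⟩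
    have h1 : (h : ℝ) ≤ n₀ := by exact_mod_cast hlt.le
    have h2 : (n₀ : ℝ) / η ≤ ⌈n₀ / η⌉₊ := Nat.le_ceil _
    rw [div_le_iff₀ hη] at h2
    have h3 : 0 ≤ η * h := by positivity
    rw [div_one]
    linarith

theorem edgeProb_le {m N L k K : ℕ} {η : ℝ} (hη : 0 < η)
    (hK : ∀ h : ℕ, 0 < h →
      ∃ c : ℝ, 0 < c ∧ ENNReal.ofReal c ≤ returnSum h ∧ h / c ≤ η * (h + K))
    (hk0 : 0 < k) (hk : m + L + 2 * k < N) {i : ℕ} (hi : i < L) {G : State} (hG : Valid m G)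
    {v u : Vertex} (hvu : Adj v u) (hu : Chain m G i u) :
    edgeProb N G (v, u) ≤ ENNReal.ofReal (2 * η * (i + 1 + K) / k) := by
  rw [edgeProb]
  split_ifs
  swap
  · exact zero_le
  obtain ⟨h1, h2⟩ := hu.abs_le hG
  obtain ⟨h3, h4⟩ : v.1.natAbs ≤ m + L ∧ v.2.natAbs ≤ i + 1 := by
    obtain ⟨s, hs, rfl⟩ := adj_iff_exists_unitStep.1 hvu
    simp only [Prod.fst_add, Prod.snd_add, abs_le] at h1 h2
    simp only [unitSteps, Finset.mem_insert, Finset.mem_singleton] at hs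
    rcases hs with rfl | rfl | rfl | rfl <;> simp only at h1 h2 <;> omega
  by_cases hv : v.2 = 0
  · rw [edgeHarm_eq_zero]
    · exact zero_le
    · exact Or.inr (Finset.mem_coe.2 (mem_segment.2 ⟨by
        rw [Int.abs_eq_natAbs]; simp only; omega, hv⟩))
  obtain ⟨c, hc0, hc, hcK⟩ := hK v.2.natAbs (by omega)
  refine (edgeHarm_le Set.subset_union_right (k := k) (by simp only; omega) hk0 hc0 hc).trans
    (ENNReal.ofReal_le_ofReal ?_)
  have h5 : (v.2.natAbs : ℝ) ≤ i + 1 := by exact_mod_cast h4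
  have hk' : (0 : ℝ) < k := by exact_mod_cast hk0
  calc 2 * (v.2.natAbs : ℝ) / (k * c) = 2 * (v.2.natAbs / c) / k := by
        field_simp
    _ ≤ 2 * (η * (v.2.natAbs + K)) / k := by gcongr
    _ ≤ 2 * η * (i + 1 + K) / k := by
        rw [← mul_assoc]
        gcongr

theorem prod_range_add_le (K L : ℕ) :
    ∏ j ∈ Finset.range L, ((j : ℝ) + 1 + K) ≤ L.factorial * 2 ^ (K + L) := by
  have h : ∏ j ∈ Finset.range L, (j + 1 + K) ≤ L.factorial * 2 ^ (K + L) := by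
    calc ∏ j ∈ Finset.range L, (j + 1 + K) = (K + 1).ascFactorial L := by
          rw [Nat.ascFactorial_eq_prod_range]
          exact Finset.prod_congr rfl fun j _ => by ring
      _ = L.factorial * (K + L).choose L := Nat.ascFactorial_eq_factorial_mul_choose _ _
      _ ≤ _ := Nat.mul_le_mul_left _ (Nat.choose_le_two_pow _ _)
  exact_mod_cast h

/-- The factorial in the number of time orderings outweighs the product of the sublinear rates. -/
theorem tsum_chainProb_le_pow {m N L k K : ℕ} {η : ℝ} (hη : 0 < η)
    (hK : ∀ h : ℕ, 0 < h →
      ∃ c : ℝ, 0 < c ∧ ENNReal.ofReal c ≤ returnSum h ∧ h / c ≤ η * (h + K))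
    (hk0 : 0 < k) (hk : m + L + 2 * k < N) :
    ∑' v, chainProb m N (2 * N) L v ≤
      ENNReal.ofReal ((2 * m + 1) * 2 ^ K * (32 * η * (N / k)) ^ L) := by
  have hk' : (0 : ℝ) < k := by exact_mod_cast hk0
  refine (tsum_chainProb_le (c := fun i => ENNReal.ofReal (2 * η * (i + 1 + K) / k))
    (fun i hi G hG v u hvu hu => edgeProb_le hη hK hk0 hk hi hG hvu hu) (2 * N) le_rfl).trans ?_
  have h1 : (2 * m + 1 : ℝ≥0∞) * ((2 * N).choose L *
      ∏ j ∈ Finset.range L, (4 * ENNReal.ofReal (2 * η * (j + 1 + K) / k))) =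
      ENNReal.ofReal ((2 * m + 1) * ((2 * N).choose L *
        ∏ j ∈ Finset.range L, (4 * (2 * η * (j + 1 + K) / k)))) := by
    rw [ENNReal.ofReal_mul (by positivity), ENNReal.ofReal_mul (by positivity),
      ENNReal.ofReal_prod_of_nonneg fun _ _ => by positivity, ENNReal.ofReal_natCast]
    congr 1
    · rw [ENNReal.ofReal_add (by positivity) zero_le_one, ENNReal.ofReal_mul zero_le_two]
      simp
    · congr 1
      refine Finset.prod_congr rfl fun j _ => ?_
      rw [ENNReal.ofReal_mul (by norm_num)]
      simp
  rw [h1]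
  refine ENNReal.ofReal_le_ofReal ?_
  rw [mul_assoc]
  refine mul_le_mul_of_nonneg_left ?_ (by positivity)
  have h2 : ∏ j ∈ Finset.range L, (4 * (2 * η * ((j : ℝ) + 1 + K) / k)) =
      (8 * η / k) ^ L * ∏ j ∈ Finset.range L, ((j : ℝ) + 1 + K) := by
    rw [← Finset.card_range L, ← Finset.prod_const, Finset.card_range, ← Finset.prod_mul_distrib]
    exact Finset.prod_congr rfl fun j _ => by ring
  have h3 : ((2 * N).choose L : ℝ) ≤ (2 * N) ^ L / L.factorial := by
    have := Nat.choose_le_pow_div (α := ℝ) L (2 * N)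
    push_cast at this
    exact this
  have hL : (0 : ℝ) < L.factorial := by exact_mod_cast L.factorial_pos
  rw [h2]
  calc ((2 * N).choose L : ℝ) * ((8 * η / k) ^ L * ∏ j ∈ Finset.range L, ((j : ℝ) + 1 + K))
      ≤ ((2 * N) ^ L / L.factorial) * ((8 * η / k) ^ L * (L.factorial * 2 ^ (K + L))) := by
        gcongr
        exact prod_range_add_le K L
    _ = 2 ^ K * ((2 * N) ^ L * (8 * η / k) ^ L * 2 ^ L) := by
        rw [pow_add]
        field_simp
    _ = 2 ^ K * (32 * η * (N / k)) ^ L := by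
        rw [← mul_pow, ← mul_pow]
        congr 2
        ring

theorem eventually_log_add_le {δ : ℝ} (hδ : 0 < δ) :
    ∀ᶠ n : ℕ in atTop, Real.log n + 8 ≤ δ * n := by
  have h1 : ∀ᶠ n : ℕ in atTop, Real.log n ≤ δ / 2 * n := by
    have := (Real.isLittleO_log_id_atTop.bound (half_pos hδ)).natCast_atTop
    filter_upwards [this] with n hn
    simpa [abs_of_nonneg (Real.log_natCast_nonneg n)] using hn
  have h2 : ∀ᶠ n : ℕ in atTop, 16 / δ ≤ n :=
    tendsto_natCast_atTop_atTop.eventually_ge_atTop (16 / δ)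
  filter_upwards [h1, h2] with n hn hn'
  rw [div_le_iff₀ hδ] at hn'
  linarith

theorem exists_forall_probInside_gt (C₁ : ℝ) {δ : ℝ} (hδ : 0 < δ) :
    ∃ M : ℕ, 0 < M ∧ ∀ m N : ℕ, M ≤ m → (m : ℝ) ≤ (1 - δ) * N →
      probInside m N (2 * N) (thinBox m) > 1 - 1 / (m : ℝ) ^ C₁ := by
  -- The rate `η` is such that the base of the power in `tsum_chainProb_le_pow` is at most
  -- `exp (-(|C₁| + 2))`, so that the power is at most `m ^ (-(|C₁| + 2))`.
  set η : ℝ := Real.exp (-(|C₁| + 2)) * δ / 256 with hηdef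
  have hη : 0 < η := by positivity
  obtain ⟨K, hK⟩ := exists_le_returnSum hη
  obtain ⟨M₁, hM₁⟩ := eventually_atTop.1 (eventually_log_add_le (half_pos hδ))
  refine ⟨max (M₁ + 1) (3 * 2 ^ K + 1), by positivity, fun m N hm hmN => ?_⟩
  have hm1 : M₁ + 1 ≤ m := (le_max_left _ _).trans hm
  have hm2 : 3 * 2 ^ K + 1 ≤ m := (le_max_right _ _).trans hm
  have hm0 : (1 : ℝ) ≤ m := by exact_mod_cast (by omega : 1 ≤ m)
  have hmN' : (m : ℝ) ≤ N := by nlinarith [Nat.cast_nonneg (α := ℝ) N]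
  have hmN'' : m ≤ N := by exact_mod_cast hmN'
  have hN0 : (0 : ℝ) < N := by linarith
  set L := ⌊Real.log m⌋₊ + 1 with hLdef
  have hL1 : Real.log m < L := by
    rw [hLdef]
    push_cast
    exact Nat.lt_floor_add_one _
  have hL2 : (L : ℝ) ≤ Real.log N + 1 := by
    rw [hLdef]
    push_cast
    have h1 := Nat.floor_le (Real.log_natCast_nonneg m)
    have h2 := Real.log_le_log (by linarith) hmN'
    linarith
  have hN := hM₁ N (by omega)
  set k := (N - m - L - 1) / 2 with hkdef
  have hlarge : (m : ℝ) + L + 7 + δ / 2 * N ≤ N := by linarith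
  have hmL : m + L + 7 ≤ N := by
    have : (m : ℝ) + L + 7 ≤ N := by
      have : 0 ≤ δ / 2 * N := by positivity
      linarith
    exact_mod_cast this
  have hk0 : 0 < k := by omega
  have hk1 : N ≤ m + L + 2 + 2 * k := by omega
  have hk2 : δ / 4 * N ≤ k := by
    have : (N : ℝ) ≤ m + L + 2 + 2 * k := by exact_mod_cast hk1
    linarith
  have hk' : (0 : ℝ) < k := by exact_mod_cast hk0
  have hsum := tsum_chainProb_le_pow hη hK hk0 (by omega : m + L + 2 * k < N)
  have hbase : 32 * η * (N / k) ≤ Real.exp (-(|C₁| + 2)) := by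
    have h1 : δ * (N / k) ≤ 4 := by
      rw [mul_div_assoc', div_le_iff₀ hk']
      linarith
    calc 32 * η * (N / k) = Real.exp (-(|C₁| + 2)) * (δ * (N / k)) / 8 := by rw [hηdef]; ring
      _ ≤ Real.exp (-(|C₁| + 2)) * 4 / 8 := by gcongr
      _ ≤ _ := by linarith [Real.exp_pos (-(|C₁| + 2))]
  have hpow : (32 * η * (N / k)) ^ L ≤ (m : ℝ) ^ (-(|C₁| + 2)) := by
    calc (32 * η * (N / k)) ^ L ≤ Real.exp (-(|C₁| + 2)) ^ L :=
          pow_le_pow_left₀ (by positivity) hbase L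
      _ = Real.exp (-(|C₁| + 2) * L) := by rw [mul_comm, Real.exp_nat_mul]
      _ ≤ Real.exp (Real.log m * -(|C₁| + 2)) := by
          refine Real.exp_le_exp.2 ?_
          nlinarith [abs_nonneg C₁]
      _ = _ := (Real.rpow_def_of_pos (by linarith) _).symm
  have hlt : (2 * m + 1) * 2 ^ K * (32 * η * (N / k)) ^ L < 1 / (m : ℝ) ^ C₁ := by
    have hmpos : (0 : ℝ) < m := by linarith
    have h3 : (3 : ℝ) * 2 ^ K < m := by exact_mod_cast hm2
    calc (2 * m + 1) * 2 ^ K * (32 * η * (N / k)) ^ L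
        ≤ (3 * m) * 2 ^ K * (m : ℝ) ^ (-(|C₁| + 2)) := by
          gcongr
          linarith
      _ = (3 * 2 ^ K) * ((m : ℝ) * (m : ℝ) ^ (-(|C₁| + 2))) := by ring
      _ < m * ((m : ℝ) * (m : ℝ) ^ (-(|C₁| + 2))) := by gcongr
      _ = (m : ℝ) ^ (-|C₁|) := by
          nth_rewrite 1 2 [← Real.rpow_one (m : ℝ)]
          rw [← Real.rpow_add hmpos, ← Real.rpow_add hmpos]
          congr 1
          ring
      _ ≤ (m : ℝ) ^ (-C₁) := Real.rpow_le_rpow_of_exponent_le hm0 (neg_le_neg (le_abs_self C₁))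
      _ = 1 / (m : ℝ) ^ C₁ := by rw [Real.rpow_neg hmpos.le, one_div]
  have := one_sub_le_probInside m N (2 * N) (by positivity) hsum
  linarith

end IntermediateDLA

theorem mainTheorem8 (C₁ : ℝ) :
    ∃ M₀ : ℕ, ∀ δ : ℝ, 0 < δ →
      ∃ N₀ : ℕ, ∀ N : ℕ, N₀ ≤ N → ∀ m : ℕ, M₀ ≤ m → (m : ℝ) ≤ (1 - δ) * N →
        IntermediateDLA.probInside m N (2 * N) (IntermediateDLA.thinBox m) >
          1 - 1 / (m : ℝ) ^ C₁ := by
  -- For `m ≤ N / 2` the threshold for `δ = 1 / 2` serves. For `m > N / 2` the threshold for `δ`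
  -- may be imposed on `N`.
  obtain ⟨M₀, -, hM₀⟩ := IntermediateDLA.exists_forall_probInside_gt C₁ one_half_pos
  refine ⟨M₀, fun δ hδ => ?_⟩
  obtain ⟨M, -, hM⟩ := IntermediateDLA.exists_forall_probInside_gt C₁ hδ
  refine ⟨2 * M, fun N hN m hm hmN => ?_⟩
  obtain h | h := le_or_gt (2 * m) N
  · refine hM₀ m N hm ?_
    have : (2 * m : ℝ) ≤ N := by exact_mod_cast h
    linarith
  · exact hM m N (by omega) hmN
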